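/- Fix $D\ge 0$. All simplicial complexes below have vertex degree at most $D$ (every vertex lies on at most $D$ edges). For a finite group $G$, a rooted simplicial $G$-complex $(K,o)$ is a simplicial complex $K$ with a simplicial $G$-action and a $G$-orbit $o$ of vertices meeting every connected component of $K$. Let $\mathcal{S}_G$ be the space of ($G$-equivariant, root-preserving) isomorphism classes $[K,o]$, with the topology of the metric $$d([K,o],[L,o'])=\inf\{2^{-r} \mid B_r(K,o)\cong_G B_r(L,o')\},$$ where $B_r(K,o)$ is the full subcomplex on the vertices of path distance at most $r$ from $o$. Let $\mathcal{S}_G^{(2)}$ be the analogous space of classes $[K,o,o']$ of doubly rooted complexes (both orbits $o$, $o'$ meeting every component; balls are taken around $o\cup o'$). A random rooted simplicial $G$-complex is a Borel probability measure $\mu$ on $\mathcal{S}_G$ that is unimodular: $$\int \sum_{x\in K^{(0)}} f([K,o,Gx])\,d\mu([K,o])=\int \sum_{x\in K^{(0)}} f([K,Gx,o])\,d\mu([K,o])$$ for all Borel functions $f\colon \mathcal{S}_G^{(2)}\to[0,\infty)$. If $K$ is a $G$-complex and $x$ a vertex, $[K,Gx]$ denotes the class of the union of the components of $K$ that meet $Gx$,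 rooted at $Gx$ (this is $K$ itself if $K$ is connected). For a nonempty finite $G$-complex $K$ put $\mu_K^G=|K^{(0)}|^{-1}\sum_{x\in K^{(0)}}\delta_{[K,Gx]}$; finite $G$-complexes $K_n$ Benjamini–Schramm converge to $\mu$ if $\mu_{K_n}^G\to\mu$ weakly. For $H\le G$ let $\mathrm{ind}_H^G$ be the push-forward of measures along $\mathcal{S}_H\to\mathcal{S}_G$, $[K,o]\mapsto[G\times_H K,\,G\lfloor 1,o\rfloor]$. **Proposition.** Let $\Gamma$ be a group acting on a nonempty simplicial complex $K$ of vertex degree at most $D$ by simplicial automorphisms, such that an element stabilizing a simplex fixes all its vertices, every vertex has finite stabilizer, and there are only finitely many orbits of vertices. Let $G\le\Gamma$ be a finite subgroup and let $H\le G$ be the subgroup of those elements of $G$ whose $\Gamma$-conjugacy class is finite. Let $\Gamma_0\le\Gamma$ be any finite-index subgroup centralizing $H$, let $\mathcal{F}_0$ be any fundamental domain for the action of $\Gamma_0$ on $K^{(0)}$ (exactly one vertex from each orbit), and put $$\mu_K^H=\frac1{w(\Gamma_0)}\sum_{x\in\mathcal{F}_0}|\mathrm{St}_{\Gamma_0}(x)|^{-1}\,\delta_{[K,Hx]},\qquad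 w(\Gamma_0)=\sum_{x\in\mathcal{F}_0}|\mathrm{St}_{\Gamma_0}(x)|^{-1}.$$ Let $N_0\ge N_1\ge N_2\ge\cdots$ be finite-index normal subgroups of $\Gamma$ with $\bigcap_n N_n=\{1\}$. Then $\mathrm{ind}_H^G(\mu_K^H)$ is a random rooted simplicial $G$-complex (that is, unimodular), and the sequence of finite simplicial $G$-complexes $(K/N_n)_n$ Benjamini–Schramm converges to it. -/

import Mathlib

open MeasureTheory Filter Topology
open scoped ENNReal NNReal

universe u

/-! ### Simplicial complexes with a group action -/

/-- The `1`-skeleton of a simplicial complex. Since faces are downward closed, two distinct vertices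
span a `1`-simplex iff they lie in a common simplex. -/
def AbstractSimplicialComplex.graph {V : Type u} (K : AbstractSimplicialComplex V) :
    SimpleGraph V where
  Adj x y := x ≠ y ∧ ∃ s ∈ K.faces, x ∈ s ∧ y ∈ s
  symm := ⟨fun _ _ ⟨h, s, hs, hx, hy⟩ => ⟨h.symm, s, hs, hy, hx⟩⟩
  loopless := ⟨fun _ h => h.1 rfl⟩

/-- A simplicial complex with vertex set `V` on which the group `G` acts by simplicial
automorphisms. -/
structure GComplex (G : Type u) [Group G] where
  V : Type u
  [act : MulAction G V]
  K : AbstractSimplicialComplex V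
  smul_mem : ∀ (g : G) (s : Finset V), s ∈ K.faces →
    s.map (MulAction.toPerm g).toEmbedding ∈ K.faces

attribute [instance] GComplex.act

namespace GComplex

variable {G : Type u} [Group G]

/-- The `1`-skeleton. -/
def graph (X : GComplex G) : SimpleGraph X.V := X.K.graph

/-- The vertex degree is at most `D`: every vertex lies in at most `D` many `1`-simplices. -/
def DegLE (X : GComplex G) (D : ℕ) : Prop := ∀ v, (X.graph.neighborSet v).encard ≤ D

/-- If `γ` stabilizes a simplex, then it fixes all of its vertices (the converse always holds). -/
def IsSimplicialAction (X : GComplex G) : Prop :=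
  ∀ (γ : G), ∀ s ∈ X.K.faces, s.map (MulAction.toPerm γ).toEmbedding = s → ∀ x ∈ s, γ • x = x

/-- Change of the acting group along a homomorphism. -/
def restrict {H : Type u} [Group H] (X : GComplex G) (f : H →* G) : GComplex H :=
  letI : MulAction H X.V := MulAction.compHom X.V f
  { V := X.V
    K := X.K
    smul_mem := fun h s hs => X.smul_mem (f h) s hs }

/-- The full subcomplex on a `G`-stable set of vertices. -/
def full (X : GComplex G) (S : SubMulAction G X.V) : GComplex G where
  V := S
  K :=
    { faces := {s | s.map (Function.Embedding.subtype _) ∈ X.K.faces}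
      isRelLowerSet_faces := by
        intro s hs
        have h := X.K.isRelLowerSet_faces hs
        refine ⟨by simpa using h.1, fun t hts ht => ?_⟩
        exact h.2 (Finset.map_subset_map.2 hts) (by simpa using ht)
      singleton_mem := fun v => by simpa using X.K.singleton_mem (v : X.V) }
  smul_mem := by
    intro g s hs
    have h := X.smul_mem g _ hs
    change Finset.map _ _ ∈ X.K.faces
    convert h using 1
    rw [Finset.map_map, Finset.map_map]
    rfl

lemma adj_smul (X : GComplex G) (g : G) {v w : X.V} (h : X.graph.Adj v w) :
    X.graph.Adj (g • v) (g • w) := by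
  obtain ⟨hne, s, hs, hv, hw⟩ := h
  refine ⟨fun h => hne (MulAction.injective g h), _, X.smul_mem g s hs, ?_, ?_⟩
  · exact Finset.mem_map.2 ⟨v, hv, rfl⟩
  · exact Finset.mem_map.2 ⟨w, hw, rfl⟩

/-- The action of a group element on the `1`-skeleton. -/
def smulHom (X : GComplex G) (g : G) : X.graph →g X.graph where
  toFun v := g • v
  map_rel' h := X.adj_smul g h

lemma reachable_smul (X : GComplex G) (g : G) {v w : X.V} (h : X.graph.Reachable v w) :
    X.graph.Reachable (g • v) (g • w) :=
  h.map (X.smulHom g)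

lemma edist_hom_le {V W : Type u} {A : SimpleGraph V} {B : SimpleGraph W} (f : A →g B) (v w : V) :
    B.edist (f v) (f w) ≤ A.edist v w := by
  by_cases h : A.Reachable v w
  · obtain ⟨p, hp⟩ := h.exists_walk_length_eq_edist
    rw [← hp]
    simpa using SimpleGraph.edist_le (p.map f)
  · rw [SimpleGraph.edist_eq_top_of_not_reachable h]
    exact le_top

lemma edist_smul_le (X : GComplex G) (g : G) (v w : X.V) :
    X.graph.edist (g • v) (g • w) ≤ X.graph.edist v w :=
  edist_hom_le (X.smulHom g) v w

lemma full_degLE {X : GComplex G} {D : ℕ} (h : X.DegLE D) (S : SubMulAction G X.V) :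
    (X.full S).DegLE D := by
  intro v
  refine le_trans (le_of_eq (Function.Injective.encard_image
    (Subtype.val_injective (p := fun x => x ∈ S)) _).symm)
    (le_trans (Set.encard_le_encard ?_) (h v.1))
  rintro _ ⟨w, ⟨hne, s, hs, hv, hw⟩, rfl⟩
  exact ⟨fun h => hne (Subtype.ext h), _, hs, Finset.mem_map.2 ⟨v, hv, rfl⟩,
    Finset.mem_map.2 ⟨w, hw, rfl⟩⟩

/-- The vertices of the connected components which meet the orbit of `x`. -/
def component (X : GComplex G) (x : X.V) : SubMulAction G X.V where
  carrier := {v | ∃ g : G, X.graph.Reachable (g • x) v}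
  smul_mem' := by
    rintro c v ⟨g, hg⟩
    exact ⟨c * g, by simpa [mul_smul] using X.reachable_smul c hg⟩

lemma mem_component {X : GComplex G} {x v : X.V} :
    v ∈ X.component x ↔ ∃ g : G, X.graph.Reachable (g • x) v := Iff.rfl

lemma self_mem_component (X : GComplex G) (x : X.V) : x ∈ X.component x :=
  mem_component.2 ⟨1, by simp⟩

lemma full_component_reachable (X : GComplex G) (x : X.V) {v w : X.V}
    (p : X.graph.Walk v w) (hv : v ∈ X.component x) :
    ∃ hw : w ∈ X.component x, (X.full (X.component x)).graph.Reachable ⟨v, hv⟩ ⟨w, hw⟩ := by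
  induction p with
  | nil => exact ⟨hv, SimpleGraph.Reachable.refl _⟩
  | @cons a b c hab p ih =>
    have hb : b ∈ X.component x := by
      obtain ⟨g, hg⟩ := mem_component.1 hv
      exact mem_component.2 ⟨g, hg.trans hab.reachable⟩
    obtain ⟨hc, hr⟩ := ih hb
    refine ⟨hc, SimpleGraph.Reachable.trans (SimpleGraph.Adj.reachable ?_) hr⟩
    obtain ⟨hne, s, hs, ha, hb'⟩ := hab
    classical
    have hsub : ({a, b} : Finset X.V) ∈ X.K.faces :=
      (X.K.isRelLowerSet_faces hs).2 (by
        intro z hz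
        simp only [Finset.mem_insert, Finset.mem_singleton] at hz
        rcases hz with rfl | rfl <;> assumption) (by simp)
    refine ⟨fun h => hne (congrArg Subtype.val h),
      ({⟨a, hv⟩, ⟨b, hb⟩} : Finset (X.component x)), ?_, ?_, ?_⟩
    · change Finset.map _ _ ∈ X.K.faces
      simpa [Finset.map_insert] using hsub
    · exact Finset.mem_insert_self (α := X.component x) _ _
    · exact Finset.mem_insert_of_mem (α := X.component x)
        (Finset.mem_singleton_self (α := X.component x) _)

end GComplex

/-! ### Rooted complexes and the space of their isomorphism classes -/

/-- A simplicial `G`-complex with `k` distinguished sets of vertices. -/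
structure MarkedComplex (G : Type u) [Group G] (k : ℕ) extends GComplex G where
  root : Fin k → Set V

namespace MarkedComplex

variable {G : Type u} [Group G] {k : ℕ}

/-- Existence of a `G`-equivariant simplicial isomorphism which maps the distinguished sets of
vertices onto each other. -/
def IsIso (X Y : MarkedComplex G k) : Prop :=
  ∃ e : X.V ≃ Y.V, (∀ (g : G) (v : X.V), e (g • v) = g • e v) ∧
    (∀ s : Finset X.V, s.map e.toEmbedding ∈ Y.K.faces ↔ s ∈ X.K.faces) ∧
    ∀ i, e '' X.root i = Y.root i

lemma IsIso.refl (X : MarkedComplex G k) : IsIso X X :=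
  ⟨Equiv.refl _, fun _ _ => rfl, fun s => by simp, fun i => by simp⟩

lemma IsIso.symm {X Y : MarkedComplex G k} (h : IsIso X Y) : IsIso Y X := by
  obtain ⟨e, h1, h2, h3⟩ := h
  refine ⟨e.symm, fun g v => ?_, fun s => ?_, fun i => ?_⟩
  · rw [Equiv.symm_apply_eq, h1, Equiv.apply_symm_apply]
  · rw [← h2, Finset.map_map]
    have : e.symm.toEmbedding.trans e.toEmbedding = Function.Embedding.refl _ := by
      ext x; simp
    rw [this, Finset.map_refl]
  · rw [← h3, Equiv.symm_image_image]

lemma IsIso.trans {X Y Z : MarkedComplex G k} (h : IsIso X Y) (h' : IsIso Y Z) : IsIso X Z := by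
  obtain ⟨e, h1, h2, h3⟩ := h
  obtain ⟨f, k1, k2, k3⟩ := h'
  refine ⟨e.trans f, fun g v => by simp [h1, k1], fun s => ?_, fun i => ?_⟩
  · rw [← h2, ← k2, Finset.map_map]
    rfl
  · rw [← k3, ← h3, Set.image_image]
    rfl

/-- `X` has vertex degree at most `D`, the distinguished sets are `G`-orbits, and each of them
touches every connected component. -/
structure IsRooted (X : MarkedComplex G k) (D : ℕ) : Prop where
  deg : X.DegLE D
  orbit : ∀ i, ∃ v, X.root i = MulAction.orbit G v
  touch : ∀ i v, ∃ w ∈ X.root i, X.graph.Reachable w v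

end MarkedComplex

/-- `k`-rooted simplicial `G`-complexes of vertex degree at most `D`; for `k = 1` these are the
rooted ones `(K, o)`, for `k = 2` the doubly rooted ones `(K, o, o')`. -/
structure RootedComplex (G : Type u) [Group G] (D k : ℕ) extends MarkedComplex G k where
  isRooted : toMarkedComplex.IsRooted D

namespace RootedComplex

variable {G : Type u} [Group G] {D k : ℕ}

lemma smul_mem_root (X : RootedComplex G D k) (g : G) {i : Fin k} {w : X.V}
    (hw : w ∈ X.root i) : g • w ∈ X.root i := by
  obtain ⟨v, hv⟩ := X.isRooted.orbit i
  rw [hv] at hw ⊢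
  exact MulAction.mem_orbit_of_mem_orbit g hw

/-- The vertices of path distance at most `r` from the roots. -/
def ballSet (X : RootedComplex G D k) (r : ℕ) : SubMulAction G X.V where
  carrier := {v | ∃ i, ∃ w ∈ X.root i, X.graph.edist w v ≤ r}
  smul_mem' := by
    rintro g v ⟨i, w, hw, h⟩
    exact ⟨i, g • w, X.smul_mem_root g hw, (X.edist_smul_le g w v).trans h⟩

lemma mem_ballSet {X : RootedComplex G D k} {r : ℕ} {v : X.V} :
    v ∈ X.ballSet r ↔ ∃ i, ∃ w ∈ X.root i, X.graph.edist w v ≤ r := Iff.rfl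

/-- The ball `B_r`: the full subcomplex on the vertices of path distance at most `r` from
the roots, together with the roots. -/
def ball (X : RootedComplex G D k) (r : ℕ) : MarkedComplex G k :=
  { X.toGComplex.full (X.ballSet r) with root := fun i => {v | v.1 ∈ X.root i} }

instance setoid (G : Type u) [Group G] (D k : ℕ) : Setoid (RootedComplex G D k) where
  r X Y := X.toMarkedComplex.IsIso Y.toMarkedComplex
  iseqv := ⟨fun X => .refl X.toMarkedComplex, fun h => h.symm, fun h h' => h.trans h'⟩

lemma ball_isIso_of_isIso {X Y : RootedComplex G D k} (h : X.toMarkedComplex.IsIso Y.toMarkedComplex) (r : ℕ) :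
    (X.ball r).IsIso (Y.ball r) := by
  have key : ∀ {X Y : RootedComplex G D k} (e : X.V ≃ Y.V),
      (∀ s : Finset X.V, s.map e.toEmbedding ∈ Y.K.faces ↔ s ∈ X.K.faces) →
      (∀ i, e '' X.root i = Y.root i) → ∀ v ∈ X.ballSet r, e v ∈ Y.ballSet r := by
    intro X Y e h2 h3 v hv
    obtain ⟨i, w, hw, hwv⟩ := mem_ballSet.1 hv
    let f : X.graph →g Y.graph :=
      { toFun := e
        map_rel' := fun {a b} ⟨hne, s, hs, ha, hb⟩ =>
          ⟨fun h => hne (e.injective h), _, (h2 s).2 hs,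
            Finset.mem_map.2 ⟨a, ha, rfl⟩, Finset.mem_map.2 ⟨b, hb, rfl⟩⟩ }
    exact mem_ballSet.2 ⟨i, e w, h3 i ▸ ⟨w, hw, rfl⟩,
      (GComplex.edist_hom_le f w v).trans hwv⟩
  obtain ⟨e, h1, h2, h3⟩ := h
  have hs2 : ∀ s : Finset Y.V, s.map e.symm.toEmbedding ∈ X.K.faces ↔ s ∈ Y.K.faces := by
    intro s
    rw [← h2, Finset.map_map]
    have : e.symm.toEmbedding.trans e.toEmbedding = Function.Embedding.refl _ := by
      ext x; simp
    rw [this, Finset.map_refl]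
  have hs3 : ∀ i, e.symm '' Y.root i = X.root i := fun i => by
    rw [← h3, Equiv.symm_image_image]
  have hiff : ∀ v, v ∈ X.ballSet r ↔ e v ∈ Y.ballSet r := fun v =>
    ⟨key e h2 h3 v, fun h => by simpa using key e.symm hs2 hs3 _ h⟩
  refine ⟨e.subtypeEquiv hiff, fun g v => Subtype.ext (h1 g v.1), fun s => ?_, fun i => ?_⟩
  · change Finset.map _ _ ∈ Y.K.faces ↔ Finset.map _ _ ∈ X.K.faces
    rw [← h2]
    refine iff_of_eq (congrArg (· ∈ Y.K.faces) ?_)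
    exact (Finset.map_map _ _ _).trans
      (Finset.map_map (Function.Embedding.subtype (· ∈ X.ballSet r)) e.toEmbedding s).symm
  · ext v
    constructor
    · rintro ⟨w, hw, rfl⟩
      exact (h3 i).subset ⟨w.1, hw, rfl⟩
    · intro hv
      have hv' : v.1 ∈ Y.root i := hv
      rw [← h3 i] at hv'
      obtain ⟨w, hw, hwv⟩ := hv'
      exact ⟨⟨w, (hiff w).2 (hwv ▸ v.2)⟩, hw, Subtype.ext hwv⟩

end RootedComplex

/-- The space of isomorphism classes of `k`-rooted simplicial `G`-complexes of vertex degree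
at most `D`. -/
def RootedSpace (G : Type u) [Group G] (D k : ℕ) : Type (u + 1) :=
  Quotient (RootedComplex.setoid G D k)

namespace RootedSpace

variable {G : Type u} [Group G] {D k : ℕ}

/-- The isomorphism class of a `k`-rooted complex. -/
def mk (X : RootedComplex G D k) : RootedSpace G D k := Quotient.mk _ X

/-- The balls of radius `r` around the roots are isomorphic. -/
def BallIso (r : ℕ) : RootedSpace G D k → RootedSpace G D k → Prop :=
  Quotient.lift₂ (fun X Y => (X.ball r).IsIso (Y.ball r)) (by
    intro X Y X' Y' hX hY
    have hX := RootedComplex.ball_isIso_of_isIso hX r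
    have hY := RootedComplex.ball_isIso_of_isIso hY r
    exact propext ⟨fun h => (hX.symm.trans h).trans hY, fun h => (hX.trans h).trans hY.symm⟩)

/-- The metric, with values in `[0, ∞]`: the infimum of all `2⁻ʳ` such that the balls of radius `r`
are isomorphic. -/
noncomputable def dist (x y : RootedSpace G D k) : ℝ≥0∞ :=
  ⨅ (r : ℕ) (_ : BallIso r x y), (2 ^ r)⁻¹

/-- The topology of the metric `dist`. -/
instance : TopologicalSpace (RootedSpace G D k) where
  IsOpen U := ∀ x ∈ U, ∃ ε > 0, ∀ y, dist x y < ε → y ∈ U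
  isOpen_univ := fun _ _ => ⟨1, one_pos, fun _ _ => trivial⟩
  isOpen_inter := by
    rintro U U' h h' x ⟨hx, hx'⟩
    obtain ⟨ε, hε, H⟩ := h x hx
    obtain ⟨ε', hε', H'⟩ := h' x hx'
    exact ⟨min ε ε', lt_min hε hε', fun y hy =>
      ⟨H y (hy.trans_le (min_le_left _ _)), H' y (hy.trans_le (min_le_right _ _))⟩⟩
  isOpen_sUnion := by
    rintro S h x ⟨U, hU, hx⟩
    obtain ⟨ε, hε, H⟩ := h U hU x hx
    exact ⟨ε, hε, fun y hy => ⟨U, hU, H y hy⟩⟩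

/-- The Borel `σ`-algebra. -/
instance : MeasurableSpace (RootedSpace G D k) := borel _

instance : BorelSpace (RootedSpace G D k) := ⟨rfl⟩

end RootedSpace

/-! ### Unimodularity -/

namespace RootedComplex

variable {G : Type u} [Group G] {D : ℕ}

lemma orbit_touch (X : RootedComplex G D 1) (x v : X.V) :
    ∃ w ∈ MulAction.orbit G x, X.graph.Reachable w v := by
  obtain ⟨o, ho⟩ := X.isRooted.orbit 0
  obtain ⟨a, ha, hav⟩ := X.isRooted.touch 0 v
  obtain ⟨b, hb, hbx⟩ := X.isRooted.touch 0 x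
  rw [ho] at ha hb
  obtain ⟨g, rfl⟩ := ha
  obtain ⟨h, rfl⟩ := hb
  refine ⟨(g * h⁻¹) • x, ⟨_, rfl⟩, ?_⟩
  have := X.reachable_smul (g * h⁻¹) hbx
  simp only [smul_smul, inv_mul_cancel_right] at this
  exact this.symm.trans hav

/-- `(K, o, Gx)` for a rooted complex `(K, o)` and a vertex `x` of `K`. -/
def outPair (X : RootedComplex G D 1) (x : X.V) : RootedComplex G D 2 :=
  ⟨{ X.toGComplex with root := ![X.root 0, MulAction.orbit G x] },
    { deg := X.isRooted.deg
      orbit := fun i => by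
        fin_cases i
        · exact X.isRooted.orbit 0
        · exact ⟨x, rfl⟩
      touch := fun i v => by
        fin_cases i
        · exact X.isRooted.touch 0 v
        · exact X.orbit_touch x v }⟩

/-- `(K, Gx, o)` for a rooted complex `(K, o)` and a vertex `x` of `K`. -/
def inPair (X : RootedComplex G D 1) (x : X.V) : RootedComplex G D 2 :=
  ⟨{ X.toGComplex with root := ![MulAction.orbit G x, X.root 0] },
    { deg := X.isRooted.deg
      orbit := fun i => by
        fin_cases i
        · exact ⟨x, rfl⟩
        · exact X.isRooted.orbit 0
      touch := fun i v => by
        fin_cases i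
        · exact X.orbit_touch x v
        · exact X.isRooted.touch 0 v }⟩

end RootedComplex

namespace RootedSpace

variable {G : Type u} [Group G] {D : ℕ}

lemma image_orbit {V W : Type u} [MulAction G V] [MulAction G W] (e : V ≃ W)
    (h : ∀ (g : G) (v : V), e (g • v) = g • e v) (x : V) :
    e '' MulAction.orbit G x = MulAction.orbit G (e x) := by
  ext w
  constructor
  · rintro ⟨_, ⟨g, rfl⟩, rfl⟩
    exact ⟨g, (h g x).symm⟩
  · rintro ⟨g, rfl⟩
    exact ⟨g • x, ⟨g, rfl⟩, h g x⟩

/-- The function `[K, o] ↦ ∑ₓ f [K, o, Gx]`, the sum being over all vertices `x` of `K`. -/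
noncomputable def massOut (f : RootedSpace G D 2 → ℝ≥0) : RootedSpace G D 1 → ℝ≥0∞ :=
  Quotient.lift (fun X => ∑' x : X.V, (f (mk (X.outPair x)) : ℝ≥0∞)) (by
    rintro X Y ⟨e, h1, h2, h3⟩
    change ∑' x : X.V, (f (mk (X.outPair x)) : ℝ≥0∞) = ∑' y : Y.V, _
    rw [← e.tsum_eq]
    refine tsum_congr fun x => ?_
    congr 2
    refine Quotient.sound ⟨e, h1, h2, fun i => ?_⟩
    fin_cases i
    · exact h3 0
    · exact image_orbit e h1 x)

/-- The function `[K, o] ↦ ∑ₓ f [K, Gx, o]`, the sum being over all vertices `x` of `K`. -/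
noncomputable def massIn (f : RootedSpace G D 2 → ℝ≥0) : RootedSpace G D 1 → ℝ≥0∞ :=
  Quotient.lift (fun X => ∑' x : X.V, (f (mk (X.inPair x)) : ℝ≥0∞)) (by
    rintro X Y ⟨e, h1, h2, h3⟩
    change ∑' x : X.V, (f (mk (X.inPair x)) : ℝ≥0∞) = ∑' y : Y.V, _
    rw [← e.tsum_eq]
    refine tsum_congr fun x => ?_
    congr 2
    refine Quotient.sound ⟨e, h1, h2, fun i => ?_⟩
    fin_cases i
    · exact image_orbit e h1 x
    · exact h3 0)

/-- Unimodularity: a random rooted simplicial `G`-complex is a unimodular probability measure. -/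
def IsUnimodular (μ : ProbabilityMeasure (RootedSpace G D 1)) : Prop :=
  ∀ f : RootedSpace G D 2 → ℝ≥0, Measurable f →
    ∫⁻ z, massOut f z ∂(μ : Measure (RootedSpace G D 1)) =
      ∫⁻ z, massIn f z ∂(μ : Measure (RootedSpace G D 1))

end RootedSpace

/-! ### The law of a finite complex -/

namespace GComplex

variable {G : Type u} [Group G]

/-- The rooted complex `(K, Gx)`, where `K` is replaced by the union of those connected components
which meet the orbit `Gx` (this is all of `K` if `K` is connected). -/
def rootAt (X : GComplex G) {D : ℕ} (hD : X.DegLE D) (x : X.V) : RootedComplex G D 1 :=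
  ⟨{ X.full (X.component x) with root := fun _ => {v | v.1 ∈ MulAction.orbit G x} },
    { deg := full_degLE hD _
      orbit := fun _ => by
        refine ⟨⟨x, X.self_mem_component x⟩, ?_⟩
        ext v
        constructor
        · rintro ⟨g, hg⟩
          exact ⟨g, Subtype.ext hg⟩
        · rintro ⟨g, rfl⟩
          exact ⟨g, rfl⟩
      touch := fun _ v => by
        obtain ⟨g, ⟨p⟩⟩ := mem_component.1 v.2
        have hg : g • x ∈ X.component x := mem_component.2 ⟨g, SimpleGraph.Reachable.refl _⟩
        obtain ⟨_, hr⟩ := X.full_component_reachable x p hg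
        exact ⟨⟨g • x, hg⟩, ⟨g, rfl⟩, hr⟩ }⟩

/-- The point `[K, Gx]`. -/
def pt (X : GComplex G) {D : ℕ} (hD : X.DegLE D) (x : X.V) : RootedSpace G D 1 :=
  RootedSpace.mk (X.rootAt hD x)

/-- The law `∑ₓ δ_[K, Gx] / |K⁽⁰⁾|` of a nonempty finite `G`-complex `K`, the sum being over all
vertices `x`. -/
noncomputable def law (X : GComplex G) {D : ℕ} (hD : X.DegLE D) [Finite X.V] [Nonempty X.V] :
    ProbabilityMeasure (RootedSpace G D 1) :=
  letI := Fintype.ofFinite X.V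
  ⟨∑ x : X.V, (Nat.card X.V : ℝ≥0∞)⁻¹ • Measure.dirac (X.pt hD x), ⟨by
    simp only [Measure.coe_finsetSum, Finset.sum_apply, Measure.smul_apply, measure_univ,
      smul_eq_mul, mul_one, Finset.sum_const, Finset.card_univ, nsmul_eq_mul,
      Nat.card_eq_fintype_card]
    exact ENNReal.mul_inv_cancel (by simp) (by simp)⟩⟩

/-! ### Quotients -/

/-- The action of `Γ` on the `N`-orbits, for a normal subgroup `N`. -/
@[reducible]
def quotientAction {V : Type u} [MulAction G V] (N : Subgroup G) [hN : N.Normal] :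
    MulAction G (MulAction.orbitRel.Quotient N V) where
  smul g := Quotient.map' (fun v => g • v) (by
    rintro v w ⟨n, rfl⟩
    exact ⟨⟨g * n * g⁻¹, hN.conj_mem n n.2 g⟩, by simp [Subgroup.smul_def, mul_smul]⟩)
  one_smul := by
    rintro ⟨v⟩
    exact congrArg (Quotient.mk _) (one_smul G v)
  mul_smul := by
    rintro a b ⟨v⟩
    exact congrArg (Quotient.mk _) (mul_smul a b v)

open Classical in
/-- The quotient complex `K / N` by a normal subgroup `N`: its vertices are the `N`-orbits of
vertices and its simplices are the images of the simplices of `K`. -/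
noncomputable def quotient (X : GComplex G) (N : Subgroup G) [N.Normal] : GComplex G :=
  letI : MulAction G (MulAction.orbitRel.Quotient N X.V) := quotientAction N
  { V := MulAction.orbitRel.Quotient N X.V
    K := PreAbstractSimplicialComplex.toAbstractSimplicialComplex _
      (X.K.toPreAbstractSimplicialComplex.map (Quotient.mk (MulAction.orbitRel N X.V))) (by
        rintro ⟨v⟩
        exact ⟨{v}, X.K.singleton_mem v, Finset.image_singleton _ _⟩)
    smul_mem := by
      rintro g _ ⟨s, hs, rfl⟩
      refine ⟨_, X.smul_mem g s hs, ?_⟩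
      ext q
      simp only [Finset.mem_image, Finset.mem_map]
      constructor
      · rintro ⟨_, ⟨a, ha, rfl⟩, rfl⟩
        exact ⟨Quotient.mk _ a, ⟨a, ha, rfl⟩, rfl⟩
      · rintro ⟨_, ⟨a, ha, rfl⟩, rfl⟩
        exact ⟨g • a, ⟨a, ha, rfl⟩, rfl⟩ }

lemma quotient_degLE {X : GComplex G} {D : ℕ} (h : X.DegLE D) (N : Subgroup G) [N.Normal] :
    (X.quotient N).DegLE D := by
  intro q
  obtain ⟨v, rfl⟩ : ∃ v, Quotient.mk (MulAction.orbitRel N X.V) v = q := Quotient.exists_rep q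
  refine le_trans (le_trans (Set.encard_le_encard ?_)
    (Set.encard_image_le (Quotient.mk (MulAction.orbitRel N X.V)) _)) (h v)
  classical
  rintro q ⟨hne, _, ⟨s, hs, rfl⟩, hv, hq⟩
  obtain ⟨a, ha, hav⟩ :=
    (Finset.mem_image (f := Quotient.mk (MulAction.orbitRel N X.V))).1 hv
  obtain ⟨b, hb, rfl⟩ :=
    (Finset.mem_image (f := Quotient.mk (MulAction.orbitRel N X.V))).1 hq
  obtain ⟨n, hn⟩ : ∃ n : N, n • v = a := Quotient.exact hav
  have hb' : (Quotient.mk (MulAction.orbitRel N X.V) ((n⁻¹ : N) • b)) =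
      Quotient.mk (MulAction.orbitRel N X.V) b := Quotient.sound ⟨n⁻¹, rfl⟩
  refine ⟨(n⁻¹ : N) • b, ⟨?_, _, X.smul_mem ((n⁻¹ : N) : G) s hs,
    Finset.mem_map.2 ⟨a, ha, ?_⟩, Finset.mem_map.2 ⟨b, hb, rfl⟩⟩, hb'⟩
  · intro hvb
    refine hne ?_
    rw [← hb', ← hvb]
  · change (n⁻¹ : N) • a = v
    rw [← hn, inv_smul_smul]

lemma restrict_degLE {H : Type u} [Group H] {X : GComplex G} {D : ℕ} (h : X.DegLE D)
    (f : H →* G) : (X.restrict f).DegLE D := h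

instance (X : GComplex G) [Nonempty X.V] (N : Subgroup G) [N.Normal] :
    Nonempty (X.quotient N).V :=
  Nonempty.map (Quotient.mk (MulAction.orbitRel N X.V)) ‹_›

instance (X : GComplex G) [Finite (MulAction.orbitRel.Quotient G X.V)] (N : Subgroup G) [N.Normal]
    [N.FiniteIndex] : Finite (X.quotient N).V :=
  show Finite (MulAction.orbitRel.Quotient N X.V) from inferInstance

instance {H : Type u} [Group H] (X : GComplex G) (f : H →* G) [h : Nonempty X.V] :
    Nonempty (X.restrict f).V := h

instance {H : Type u} [Group H] (X : GComplex G) (f : H →* G) [h : Finite X.V] :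
    Finite (X.restrict f).V := h

/-! ### Induction -/

/-- The relation `(g, y) ∼ (g h, h⁻¹ y)` on `G × Y`. -/
def indSetoid (H : Subgroup G) (Y : Type u) [MulAction H Y] : Setoid (G × Y) where
  r p q := ∃ h : H, q = (p.1 * h, h⁻¹ • p.2)
  iseqv :=
    { refl := fun p => ⟨1, by simp⟩
      symm := by
        rintro ⟨g, y⟩ _ ⟨h, rfl⟩
        exact ⟨h⁻¹, by simp⟩
      trans := by
        rintro ⟨g, y⟩ _ _ ⟨h, rfl⟩ ⟨h', rfl⟩
        exact ⟨h * h', by simp [mul_assoc, mul_smul]⟩ }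

/-- The induced `G`-set `G ×_H Y`. -/
def IndSet (H : Subgroup G) (Y : Type u) [MulAction H Y] : Type u := Quotient (indSetoid H Y)

/-- The embedding `y ↦ ⌊g, y⌋` of `Y` into `G ×_H Y`. -/
def inc (H : Subgroup G) (Y : Type u) [MulAction H Y] (g : G) : Y ↪ IndSet H Y where
  toFun y := Quotient.mk _ (g, y)
  inj' := by
    intro y y' hy
    obtain ⟨h, hh⟩ : ∃ h : H, (g, y') = (g * h, h⁻¹ • y) := Quotient.exact hy
    have h1 : h = 1 := by
      have := congrArg Prod.fst hh
      simpa using this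
    subst h1
    simpa using (congrArg Prod.snd hh).symm

lemma inc_surj {H : Subgroup G} {Y : Type u} [MulAction H Y] (p : IndSet H Y) :
    ∃ g y, inc H Y g y = p := by
  obtain ⟨⟨g, y⟩⟩ := p
  exact ⟨g, y, rfl⟩

lemma inc_mul {H : Subgroup G} {Y : Type u} [MulAction H Y] (g : G) (h : H) (y : Y) :
    inc H Y (g * h) y = inc H Y g (h • y) :=
  Quotient.sound ⟨h⁻¹, by simp⟩

lemma inc_eq_iff {H : Subgroup G} {Y : Type u} [MulAction H Y] {g g' : G} {y y' : Y} :
    inc H Y g y = inc H Y g' y' ↔ ∃ h : H, g' = g * h ∧ y' = h⁻¹ • y := by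
  constructor
  · intro h
    obtain ⟨h, hh⟩ : ∃ h : H, (g', y') = (g * h, h⁻¹ • y) := Quotient.exact h
    exact ⟨h, congrArg Prod.fst hh, congrArg Prod.snd hh⟩
  · rintro ⟨h, rfl, rfl⟩
    rw [inc_mul, smul_inv_smul]

instance (H : Subgroup G) (Y : Type u) [MulAction H Y] : MulAction G (IndSet H Y) where
  smul a := Quotient.map (fun p => (a * p.1, p.2)) (by
    rintro ⟨g, y⟩ _ ⟨h, rfl⟩
    exact ⟨h, by simp [mul_assoc]⟩)
  one_smul := by
    rintro ⟨g, y⟩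
    change inc H Y (1 * g) y = inc H Y g y
    rw [one_mul]
  mul_smul := by
    rintro a b ⟨g, y⟩
    change inc H Y (a * b * g) y = inc H Y (a * (b * g)) y
    rw [mul_assoc]

lemma smul_inc {H : Subgroup G} {Y : Type u} [MulAction H Y] (a g : G) (y : Y) :
    a • inc H Y g y = inc H Y (a * g) y := rfl

/-- The induced complex `G ×_H K`: its simplices are the sets `{⌊g, x⌋ | x ∈ σ}` for `g ∈ G` and
simplices `σ` of `K`. -/
def ind (H : Subgroup G) (X : GComplex H) : GComplex G where
  V := IndSet H X.V
  K :=
    { faces := {t | ∃ g : G, ∃ σ ∈ X.K.faces, t = σ.map (inc H X.V g)}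
      isRelLowerSet_faces := by
        rintro _ ⟨g, σ, hσ, rfl⟩
        refine ⟨by simpa using (X.K.isRelLowerSet_faces hσ).1, fun t ht hne => ?_⟩
        obtain ⟨τ, hτ, rfl⟩ := Finset.subset_map_iff.1 ht
        exact ⟨g, τ, (X.K.isRelLowerSet_faces hσ).2 hτ (by simpa using hne), rfl⟩
      singleton_mem := fun p => by
        obtain ⟨g, y, rfl⟩ := inc_surj p
        exact ⟨g, {y}, X.K.singleton_mem y, by simp⟩ }
  smul_mem := by
    rintro a _ ⟨g, σ, hσ, rfl⟩
    refine ⟨a * g, σ, hσ, ?_⟩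
    rw [Finset.map_map]
    rfl

variable {H : Subgroup G}

lemma ind_face {X : GComplex H} {t : Finset (X.ind H).V} (ht : t ∈ (X.ind H).K.faces) {g : G}
    {y : X.V} (hy : inc H X.V g y ∈ t) : ∃ σ ∈ X.K.faces, t = σ.map (inc H X.V g) := by
  obtain ⟨g', σ, hσ, rfl⟩ := ht
  obtain ⟨x, hx, hxy⟩ := Finset.mem_map.1 hy
  obtain ⟨h, rfl, rfl⟩ := inc_eq_iff.1 hxy
  refine ⟨_, X.smul_mem h⁻¹ σ hσ, ?_⟩
  rw [Finset.map_map]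
  congr 1
  ext z
  change inc H X.V g' z = inc H X.V (g' * h) (h⁻¹ • z)
  rw [inc_mul, smul_inv_smul]

lemma ind_adj {X : GComplex H} {g : G} {y : X.V} {p : (X.ind H).V}
    (h : (X.ind H).graph.Adj (inc H X.V g y) p) :
    ∃ y', X.graph.Adj y y' ∧ inc H X.V g y' = p := by
  obtain ⟨hne, t, ht, hy, hp⟩ := h
  obtain ⟨σ, hσ, rfl⟩ := ind_face ht hy
  obtain ⟨y', hy', rfl⟩ := Finset.mem_map.1 hp
  refine ⟨y', ⟨fun h => hne (congrArg _ h), σ, hσ, ?_, hy'⟩, rfl⟩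
  exact (Finset.mem_map' _).1 hy

/-- The embedding `y ↦ ⌊g, y⌋` on `1`-skeleta. -/
def incHom (X : GComplex H) (g : G) : X.graph →g (X.ind H).graph where
  toFun := inc H X.V g
  map_rel' := fun ⟨hne, s, hs, ha, hb⟩ =>
    ⟨fun h => hne ((inc H X.V g).injective h), _, ⟨g, s, hs, rfl⟩,
      Finset.mem_map_of_mem _ ha, Finset.mem_map_of_mem _ hb⟩

lemma ind_walk {X : GComplex H} {g : G} {p q : (X.ind H).V} (w : (X.ind H).graph.Walk p q) :
    ∀ y : X.V, inc H X.V g y = p →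
      ∃ y', inc H X.V g y' = q ∧ X.graph.edist y y' ≤ w.length := by
  induction w with
  | nil => exact fun y hy => ⟨y, hy, by simp⟩
  | cons hab w ih =>
    rintro y rfl
    obtain ⟨y1, h1, rfl⟩ := ind_adj hab
    obtain ⟨y', h2, h3⟩ := ih y1 rfl
    refine ⟨y', h2, (X.graph.edist_triangle (v := y1)).trans ?_⟩
    have hl : ((SimpleGraph.Walk.cons hab w).length : ℕ∞) = 1 + w.length := by
      rw [add_comm]
      exact Nat.cast_succ _
    exact (add_le_add (SimpleGraph.edist_eq_one_iff_adj.2 h1).le h3).trans hl.ge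

lemma ind_degLE {X : GComplex H} {D : ℕ} (h : X.DegLE D) : (X.ind H).DegLE D := by
  intro p
  obtain ⟨g, y, rfl⟩ := inc_surj p
  refine le_trans (le_trans (Set.encard_le_encard ?_)
    (Set.encard_image_le (inc H X.V g) _)) (h y)
  intro q hq
  obtain ⟨y', h1, h2⟩ := ind_adj hq
  exact ⟨y', h1, h2⟩

end GComplex

namespace MarkedComplex

open GComplex

variable {G : Type u} [Group G] {H : Subgroup G} {k : ℕ}

/-- The induced complex `G ×_H K`, with the distinguished sets `G⌊1, o⌋`. -/
def ind (H : Subgroup G) (X : MarkedComplex H k) : MarkedComplex G k :=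
  { X.toGComplex.ind H with
    root := fun i => {p | ∃ g : G, ∃ y ∈ X.root i, p = g • inc H X.V 1 y} }

lemma ind_isIso {X Y : MarkedComplex H k} (h : X.IsIso Y) : (X.ind H).IsIso (Y.ind H) := by
  obtain ⟨e, h1, h2, h3⟩ := h
  have key : ∀ p q : G × X.V, (indSetoid H X.V) p q ↔
      (indSetoid H Y.V) (Equiv.prodCongr (Equiv.refl G) e p)
        (Equiv.prodCongr (Equiv.refl G) e q) := by
    rintro ⟨g, y⟩ ⟨g', y'⟩
    constructor
    · rintro ⟨h, hh⟩
      refine ⟨h, ?_⟩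
      rw [Prod.ext_iff] at hh ⊢
      refine ⟨hh.1, ?_⟩
      change e y' = h⁻¹ • e y
      rw [← h1]
      exact congrArg e hh.2
    · rintro ⟨h, hh⟩
      refine ⟨h, ?_⟩
      rw [Prod.ext_iff] at hh ⊢
      refine ⟨hh.1, e.injective ?_⟩
      rw [h1]
      exact hh.2
  let E : IndSet H X.V ≃ IndSet H Y.V :=
    Quotient.congr (Equiv.prodCongr (Equiv.refl G) e) key
  have hE : ∀ g y, E (inc H X.V g y) = inc H Y.V g (e y) := fun _ _ => rfl
  have hmap : ∀ (g : G) (σ : Finset X.V), (σ.map (inc H X.V g)).map E.toEmbedding =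
      (σ.map e.toEmbedding).map (inc H Y.V g) := by
    intro g σ
    rw [Finset.map_map, Finset.map_map]
    rfl
  refine ⟨E, fun a p => ?_, fun t => ?_, fun i => ?_⟩
  · obtain ⟨g, y, rfl⟩ := inc_surj p
    rfl
  · constructor
    · rintro ⟨g, σ, hσ, hts⟩
      obtain ⟨τ, rfl⟩ : ∃ τ : Finset X.V, τ.map e.toEmbedding = σ :=
        ⟨σ.map e.symm.toEmbedding, by
          rw [Finset.map_map]
          have : e.symm.toEmbedding.trans e.toEmbedding = Function.Embedding.refl _ := by
            ext x; simp
          rw [this, Finset.map_refl]⟩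
      refine ⟨g, τ, (h2 τ).1 hσ, ?_⟩
      exact Finset.map_injective E.toEmbedding (hts.trans (hmap g τ).symm)
    · rintro ⟨g, σ, hσ, rfl⟩
      exact ⟨g, σ.map e.toEmbedding, (h2 σ).2 hσ, hmap g σ⟩
  · ext p
    constructor
    · rintro ⟨_, ⟨g, y, hy, rfl⟩, rfl⟩
      exact ⟨g, e y, (h3 i).subset ⟨y, hy, rfl⟩, rfl⟩
    · rintro ⟨g, z, hz, rfl⟩
      obtain ⟨y, hy, rfl⟩ := (h3 i).superset hz
      exact ⟨g • inc H X.V 1 y, ⟨g, y, hy, rfl⟩, rfl⟩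

end MarkedComplex

namespace RootedComplex

open GComplex

variable {G : Type u} [Group G] {H : Subgroup G} {D : ℕ}

/-- The induced rooted complex `(G ×_H K, G⌊1, o⌋)`. -/
def ind (H : Subgroup G) (X : RootedComplex H D 1) : RootedComplex G D 1 :=
  ⟨X.toMarkedComplex.ind H,
    { deg := ind_degLE X.isRooted.deg
      orbit := fun i => by
        obtain ⟨v, hv⟩ := X.isRooted.orbit i
        refine ⟨inc H X.V 1 v, ?_⟩
        ext p
        constructor
        · rintro ⟨g, y, hy, rfl⟩
          rw [hv] at hy
          obtain ⟨h, rfl⟩ := hy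
          refine ⟨g * h, ?_⟩
          change inc H X.V (g * h * 1) v = inc H X.V (g * 1) (h • v)
          rw [mul_one, mul_one, inc_mul]
        · rintro ⟨g, rfl⟩
          exact ⟨g, v, hv ▸ MulAction.mem_orbit_self v, rfl⟩
      touch := fun i p => by
        obtain ⟨g, y, rfl⟩ := inc_surj p
        obtain ⟨w, hw, hwy⟩ := X.isRooted.touch i y
        refine ⟨inc H X.V g w, ⟨g, w, hw, ?_⟩, hwy.map (incHom X.toGComplex g)⟩
        rw [smul_inc, mul_one] }⟩

lemma mem_ind_root {X : RootedComplex H D 1} {i : Fin 1} {g : G} {y : X.V} :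
    inc H X.V g y ∈ (X.ind H).root i ↔ y ∈ X.root i := by
  constructor
  · rintro ⟨g', y', hy', h⟩
    have h' : inc H X.V g' y' = inc H X.V g y := by
      rw [← mul_one g', ← smul_inc]
      exact h.symm
    obtain ⟨h, rfl, rfl⟩ := inc_eq_iff.1 h'
    exact X.smul_mem_root _ hy'
  · intro hy
    exact ⟨g, y, hy, by rw [smul_inc, mul_one]⟩

lemma mem_ind_ballSet {X : RootedComplex H D 1} {r : ℕ} {g : G} {y : X.V} :
    inc H X.V g y ∈ (X.ind H).ballSet r ↔ y ∈ X.ballSet r := by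
  constructor
  · intro h
    obtain ⟨i, p, hp, hpy⟩ := mem_ballSet.1 h
    have hr : (X.toGComplex.ind H).graph.Reachable p (inc H X.V g y) :=
      SimpleGraph.reachable_of_edist_ne_top (ne_top_of_le_ne_top (ENat.natCast_ne_top r) hpy)
    obtain ⟨w, hw⟩ := hr.symm.exists_walk_length_eq_edist
    obtain ⟨y', rfl, hy'⟩ := ind_walk w y rfl
    refine mem_ballSet.2 ⟨i, y', mem_ind_root.1 hp, ?_⟩
    rw [SimpleGraph.edist_comm]
    exact hy'.trans (hw.le.trans (SimpleGraph.edist_comm.le.trans hpy))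
  · intro h
    obtain ⟨i, w, hw, hwy⟩ := mem_ballSet.1 h
    exact mem_ballSet.2 ⟨i, inc H X.V g w, mem_ind_root.2 hw,
      (edist_hom_le (incHom X.toGComplex g) w y).trans hwy⟩

lemma ball_ind_isIso (X : RootedComplex H D 1) (r : ℕ) :
    ((X.ball r).ind H).IsIso ((X.ind H).ball r) := by
  let F : IndSet H (X.ballSet r) → IndSet H X.V :=
    Quotient.map (fun p => (p.1, p.2.1)) (by
      rintro ⟨g, y⟩ _ ⟨h, rfl⟩
      exact ⟨h, rfl⟩)
  have hF : ∀ g y, F (inc H (X.ballSet r) g y) = inc H X.V g y.1 := fun _ _ => rfl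
  have hmem : ∀ p, F p ∈ (X.ind H).ballSet r := by
    intro p
    obtain ⟨g, y, rfl⟩ := inc_surj p
    exact mem_ind_ballSet.2 y.2
  have hbij : Function.Bijective (fun p => (⟨F p, hmem p⟩ : (X.ind H).ballSet r)) := by
    constructor
    · intro p q hpq
      obtain ⟨g, y, rfl⟩ := inc_surj p
      obtain ⟨g', y', rfl⟩ := inc_surj q
      have h : inc H X.V g y.1 = inc H X.V g' y'.1 := congrArg Subtype.val hpq
      obtain ⟨c, rfl, hy⟩ := inc_eq_iff.1 h
      exact inc_eq_iff.2 ⟨c, rfl, Subtype.ext hy⟩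
    · rintro ⟨p, hp⟩
      obtain ⟨g, y, rfl⟩ := inc_surj p
      exact ⟨inc H (X.ballSet r) g ⟨y, mem_ind_ballSet.1 hp⟩, rfl⟩
  let E := Equiv.ofBijective _ hbij
  have hmap : ∀ (g : G) (σ : Finset (X.ballSet r)),
      ((σ.map (inc H (X.ballSet r) g)).map E.toEmbedding).map
        (Function.Embedding.subtype (· ∈ (X.ind H).ballSet r)) =
      (σ.map (Function.Embedding.subtype (· ∈ X.ballSet r))).map (inc H X.V g) := by
    intro g σ
    rw [Finset.map_map, Finset.map_map, Finset.map_map]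
    rfl
  refine ⟨E, fun a p => ?_, fun t => ?_, fun i => ?_⟩
  · obtain ⟨g, y, rfl⟩ := inc_surj p
    rfl
  · constructor
    · rintro ⟨g, σ, hσ, hts⟩
      have hσ' : ∀ x ∈ σ, x ∈ X.ballSet r := by
        intro x hx
        have hx' : inc H X.V g x ∈ σ.map (inc H X.V g) := Finset.mem_map_of_mem _ hx
        rw [← hts] at hx'
        obtain ⟨p, _, hpx⟩ := Finset.mem_map.1 hx'
        have hp : inc H X.V g x ∈ (X.ind H).ballSet r := hpx ▸ p.2
        exact mem_ind_ballSet.1 hp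
      let τ : Finset (X.ballSet r) := σ.attach.map
        ⟨fun x => ⟨x.1, hσ' x.1 x.2⟩, fun x y h => Subtype.ext (Subtype.mk.inj h)⟩
      have hτ : τ.map (Function.Embedding.subtype (· ∈ X.ballSet r)) = σ := by
        rw [Finset.map_map]
        exact σ.attach_map_val
      refine ⟨g, τ, ?_, ?_⟩
      · change Finset.map _ _ ∈ X.K.faces
        rw [hτ]
        exact hσ
      · refine Finset.map_injective E.toEmbedding (Finset.map_injective
          (Function.Embedding.subtype (· ∈ (X.ind H).ballSet r)) ?_)
        refine hts.trans ?_
        rw [← hτ]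
        exact (hmap g τ).symm
    · rintro ⟨g, σ, hσ, rfl⟩
      exact ⟨g, _, hσ, hmap g σ⟩
  · ext ⟨p, hp⟩
    obtain ⟨g, y, rfl⟩ := inc_surj p
    have hy := mem_ind_ballSet.1 hp
    constructor
    · rintro ⟨_, ⟨a, z, hz, rfl⟩, h⟩
      have h' : a • inc H X.V 1 z.1 = inc H X.V g y := congrArg Subtype.val h
      exact ⟨a, z.1, hz, h'.symm⟩
    · intro h
      have hr : y ∈ X.root i := mem_ind_root.1 h
      refine ⟨inc H (X.ballSet r) g ⟨y, hy⟩, ⟨g, ⟨y, hy⟩, hr, ?_⟩, rfl⟩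
      change _ = inc H (X.ballSet r) (g * 1) ⟨y, hy⟩
      rw [mul_one]

end RootedComplex

namespace RootedSpace

variable {G : Type u} [Group G] {D : ℕ}

/-- The map `ind_H^G : [K, o] ↦ [G ×_H K, G⌊1, o⌋]`. -/
def ind (H : Subgroup G) : RootedSpace H D 1 → RootedSpace G D 1 :=
  Quotient.map (RootedComplex.ind H) (fun _ _ h => MarkedComplex.ind_isIso h)

lemma ballIso_ind {H : Subgroup G} {r : ℕ} {x y : RootedSpace H D 1} (h : BallIso r x y) :
    BallIso r (ind H x) (ind H y) := by
  obtain ⟨X, rfl⟩ := Quotient.exists_rep x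
  obtain ⟨Y, rfl⟩ := Quotient.exists_rep y
  have h' : (X.ball r).IsIso (Y.ball r) := h
  exact ((X.ball_ind_isIso r).symm.trans (MarkedComplex.ind_isIso h')).trans (Y.ball_ind_isIso r)

lemma dist_ind_le {H : Subgroup G} (x y : RootedSpace H D 1) :
    dist (ind H x) (ind H y) ≤ dist x y :=
  le_iInf₂ fun r h => iInf₂_le r (ballIso_ind h)

lemma continuous_ind (H : Subgroup G) : Continuous (ind (D := D) H) := by
  refine ⟨fun U hU x hx => ?_⟩
  obtain ⟨ε, hε, h⟩ := hU _ hx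
  exact ⟨ε, hε, fun y hy => h _ ((dist_ind_le x y).trans_lt hy)⟩

/-- The induced law `ind_H^G(μ)`: the push-forward along `ind_H^G`. -/
noncomputable def indLaw (H : Subgroup G) (μ : ProbabilityMeasure (RootedSpace H D 1)) :
    ProbabilityMeasure (RootedSpace G D 1) :=
  μ.map (f := ind H) (continuous_ind H).measurable.aemeasurable

end RootedSpace

/-! ### The limit law -/

namespace GComplex

variable {Γ : Type u} [Group Γ]

/-- `F` is a fundamental domain for the action of `Γ₀` on the vertices: it contains exactly one
point of each orbit. -/
def IsFundamentalDomain (X : GComplex Γ) (Γ₀ : Subgroup Γ) (F : Finset X.V) : Prop :=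
  ∀ x : X.V, ∃! y, y ∈ F ∧ y ∈ MulAction.orbit Γ₀ x

/-- The weight `w(Γ₀) = ∑_{x ∈ F} |St_{Γ₀}(x)|⁻¹`. -/
noncomputable def weight (X : GComplex Γ) (Γ₀ : Subgroup Γ) (F : Finset X.V) : ℝ≥0∞ :=
  ∑ x ∈ F, (Nat.card (MulAction.stabilizer Γ₀ x) : ℝ≥0∞)⁻¹

/-- The law `w(Γ₀)⁻¹ ∑_{x ∈ F} |St_{Γ₀}(x)|⁻¹ δ_[K, Hx]`, for a group `H` acting on `K` via
`f : H → Γ`. -/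
noncomputable def orbitLaw (X : GComplex Γ) {D : ℕ} (hD : X.DegLE D) {H : Type u} [Group H]
    (f : H →* Γ) (Γ₀ : Subgroup Γ) (F : Finset X.V) (hF : X.IsFundamentalDomain Γ₀ F)
    (hproper : ∀ x : X.V, Finite (MulAction.stabilizer Γ x)) [Nonempty X.V] :
    ProbabilityMeasure (RootedSpace H D 1) :=
  ⟨(X.weight Γ₀ F)⁻¹ • ∑ x ∈ F, (Nat.card (MulAction.stabilizer Γ₀ x) : ℝ≥0∞)⁻¹ •
      Measure.dirac ((X.restrict f).pt (restrict_degLE hD f) x), ⟨by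
    have hfin : ∀ x : X.V, Nat.card (MulAction.stabilizer Γ₀ x) ≠ 0 := by
      intro x
      have := hproper x
      have : Finite (MulAction.stabilizer Γ₀ x) := by
        refine Finite.of_injective (β := MulAction.stabilizer Γ x)
          (fun g => ⟨(g : Γ₀), g.2⟩) ?_
        intro a b hab
        exact Subtype.ext (Subtype.ext (Subtype.mk.inj hab))
      exact Nat.card_pos.ne'
    simp only [Measure.coe_finsetSum, Finset.sum_apply, Measure.smul_apply, measure_univ,
      smul_eq_mul, mul_one]
    refine ENNReal.inv_mul_cancel ?_ ?_
    · obtain ⟨y, ⟨hy, _⟩, _⟩ := hF (Classical.arbitrary X.V)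
      intro h0
      rw [weight, Finset.sum_eq_zero_iff] at h0
      simpa using h0 y hy
    · exact ENNReal.sum_ne_top.2 fun x _ => ENNReal.inv_ne_top.2 (by simpa using hfin x)⟩⟩

end GComplex

/-- The subgroup of those elements of `G` which have a finite conjugacy class in `Γ`. -/
def fcSubgroup {Γ : Type u} [Group Γ] (G : Subgroup Γ) : Subgroup G where
  carrier := {g | (conjugatesOf (g : Γ)).Finite}
  one_mem' := by
    refine (Set.finite_singleton (1 : Γ)).subset fun x hx => ?_
    exact isConj_one_right.1 hx
  mul_mem' := by
    intro a b ha hb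
    refine (Set.Finite.image2 (· * ·) ha hb).subset fun x hx => ?_
    obtain ⟨c, rfl⟩ := isConj_iff.1 hx
    refine ⟨c * a * c⁻¹, isConj_iff.2 ⟨c, rfl⟩, c * b * c⁻¹, isConj_iff.2 ⟨c, rfl⟩, ?_⟩
    simp [mul_assoc]
  inv_mem' := by
    intro a ha
    refine (Set.Finite.image (·⁻¹) ha).subset fun x hx => ?_
    obtain ⟨c, rfl⟩ := isConj_iff.1 hx
    refine ⟨c * a * c⁻¹, isConj_iff.2 ⟨c, rfl⟩, ?_⟩
    simp [mul_assoc]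

/-!
Write `H` for the subgroup of the elements of `G` with finite `Γ`-conjugacy class and `[K, Hx]` for
the point `pt x`.

*Averaging.* A *weight* for a group `Λ` acting on the vertices is a function `θ` whose sum along each
orbit map `Λ → V` is `1` (`IsWeight`); the fundamental domain with its inverse stabilizer orders is
one. For a diagonally `Λ`-invariant `Ψ`, exchanging sums gives the mass transport principle
`∑ θ(x) Ψ(x, y) = ∑ Ψ(x, y) θ(y)` (`IsWeight.mass_transport`). Two consequences are used. The
normalized sum of an invariant function against a weight does not depend on the finite-index group
(`IsWeight.tsum_mul_comm`), so the average over `Γ₀` may be computed with `N n`. And the limit law is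
unimodular (`GComplex.isUnimodular_indLaw_orbitLaw`): since `Γ₀` commutes with `H`, the mass sent in
`G ×_H K` from the orbit of `x` to the orbit of `y` is a diagonally `Γ₀`-invariant function of
`(x, y)`. To evaluate integrals against Dirac masses without measurability hypotheses, one uses that
points of the space of rooted complexes are closed, a compactness statement for finite balls
(`RootedComplex.isIso_of_ball_isIso`).

*Convergence.* The map `⌊g, y⌋ ↦ g ȳ` from `G ×_H K` to `K / N` lifts simplices at every vertex, so
it is an isomorphism on `r`-balls as soon as it is injective on `(r + 1)`-balls
(`RootedComplex.ball_isIso_of_injOn`). Injectivity around the orbit of `x` fails only if some element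
of a coset `N k`, `k ∈ G`, moves a vertex near `x` to a vertex near `x`, and either `k ∉ H` or the
element differs from `k` (`GComplex.ball_quotient_isIso`). For `k ∈ H` and `N = N n` with `n` large
this does not happen at all, because up to conjugacy only finitely many elements have to be kept out
of `N n` (`GComplex.eventually_eq_of_mem_moveSet`). For `k ∉ H` the bad vertices for `k` have many
translates, one for each conjugate of `k`, but each vertex lies in a bounded number of these, so
their proportion tends to `0` (`GComplex.eventually_mul_ncard_badSet_le`).
-/

/-! ### Finiteness of balls -/

namespace GComplex

variable {G : Type u} [Group G]

lemma exists_walk_of_edist_le {V : Type u} {A : SimpleGraph V} {v w : V} {r : ℕ}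
    (h : A.edist v w ≤ r) : ∃ p : A.Walk v w, p.length ≤ r := by
  have hr : A.Reachable v w :=
    SimpleGraph.reachable_of_edist_ne_top (ne_top_of_le_ne_top (ENat.natCast_ne_top r) h)
  obtain ⟨p, hp⟩ := hr.exists_walk_length_eq_edist
  exact ⟨p, by rw [← hp] at h; exact_mod_cast h⟩

/-- Finitely many vertices are the ends of walks of a given length from a given vertex. -/
lemma finite_walk_ends {X : GComplex G} {D : ℕ} (hD : X.DegLE D) (n : ℕ) :
    ∀ v : X.V, {w | ∃ p : X.graph.Walk v w, p.length = n}.Finite := by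
  induction n with
  | zero =>
    intro v
    refine (Set.finite_singleton v).subset ?_
    rintro w ⟨p, hp⟩
    exact (SimpleGraph.Walk.eq_of_length_eq_zero hp).symm
  | succ n ih =>
    intro v
    have hv : (X.graph.neighborSet v).Finite :=
      Set.finite_of_encard_le_coe (hD v)
    refine (hv.biUnion fun u _ => ih u).subset ?_
    rintro w ⟨p, hp⟩
    cases p with
    | nil => simp at hp
    | cons h p =>
      exact Set.mem_biUnion (show _ ∈ X.graph.neighborSet v from h) ⟨p, by simpa using hp⟩

lemma finite_edist_le {X : GComplex G} {D : ℕ} (hD : X.DegLE D) (v : X.V) (r : ℕ) :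
    {w | X.graph.edist v w ≤ r}.Finite := by
  refine ((Set.finite_Iic r).biUnion fun n _ => finite_walk_ends hD n v).subset ?_
  intro w hw
  obtain ⟨p, hp⟩ := exists_walk_of_edist_le hw
  exact Set.mem_biUnion (show p.length ∈ Set.Iic r from hp) ⟨p, rfl⟩

lemma pair_mem_faces_iff (X : GComplex G) [DecidableEq X.V] {v w : X.V} (h : v ≠ w) :
    X.graph.Adj v w ↔ ({v, w} : Finset X.V) ∈ X.K.faces := by
  constructor
  · rintro ⟨_, s, hs, hv, hw⟩
    refine (X.K.isRelLowerSet_faces hs).2 ?_ (Finset.insert_nonempty _ _)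
    intro z hz
    simp only [Finset.mem_insert, Finset.mem_singleton] at hz
    rcases hz with rfl | rfl <;> assumption
  · intro hs
    exact ⟨h, _, hs, by simp, by simp⟩

/-- A set of vertices in a full subcomplex is a set of vertices of the subcomplex. -/
lemma exists_map_subtype_eq (X : GComplex G) (S : SubMulAction G X.V) {s : Finset X.V}
    (hs : ∀ v ∈ s, v ∈ S) :
    ∃ t : Finset S, t.map (Function.Embedding.subtype (· ∈ S)) = s := by
  refine ⟨s.attach.map ⟨fun x => ⟨x.1, hs x.1 x.2⟩, fun x y h => Subtype.ext (Subtype.mk.inj h)⟩, ?_⟩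
  rw [Finset.map_map]
  exact s.attach_map_val

end GComplex

namespace RootedComplex

variable {G : Type u} [Group G] {D k : ℕ}

lemma finite_ballSet [Finite G] (X : RootedComplex G D k) (r : ℕ) :
    (X.ballSet r : Set X.V).Finite := by
  have h : ∀ i, (X.root i).Finite := by
    intro i
    obtain ⟨v, hv⟩ := X.isRooted.orbit i
    rw [hv]
    exact Set.finite_range _
  refine (Set.finite_iUnion fun i => (h i).biUnion fun w _ =>
    GComplex.finite_edist_le X.isRooted.deg w r).subset ?_
  rintro v ⟨i, w, hw, hv⟩
  exact Set.mem_iUnion.2 ⟨i, Set.mem_biUnion hw hv⟩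

lemma ballSet_mono (X : RootedComplex G D k) {r r' : ℕ} (h : r ≤ r') {v : X.V}
    (hv : v ∈ X.ballSet r) : v ∈ X.ballSet r' := by
  obtain ⟨i, w, hw, hwv⟩ := mem_ballSet.1 hv
  exact mem_ballSet.2 ⟨i, w, hw, hwv.trans (by exact_mod_cast h)⟩

lemma root_subset_ballSet (X : RootedComplex G D k) {i : Fin k} {v : X.V} (hv : v ∈ X.root i)
    (r : ℕ) : v ∈ X.ballSet r :=
  mem_ballSet.2 ⟨i, v, hv, by simp⟩

lemma adj_mem_ballSet (X : RootedComplex G D k) {r : ℕ} {v w : X.V} (hv : v ∈ X.ballSet r)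
    (h : X.graph.Adj v w) : w ∈ X.ballSet (r + 1) := by
  obtain ⟨i, a, ha, hav⟩ := mem_ballSet.1 hv
  refine mem_ballSet.2 ⟨i, a, ha, (X.graph.edist_triangle (v := v)).trans ?_⟩
  push_cast
  exact add_le_add hav (SimpleGraph.edist_eq_one_iff_adj.2 h).le

/-- An isomorphism between the balls of radius `r`, recorded as a relation between the vertices of
the ambient complexes, so that isomorphisms for different radii can be compared. -/
structure BallMatch (X Y : RootedComplex G D k) (r : ℕ) (R : X.V → Y.V → Prop) : Prop where
  left_total : ∀ v ∈ X.ballSet r, ∃ w, R v w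
  right_total : ∀ w ∈ Y.ballSet r, ∃ v, R v w
  right_unique : ∀ {v w w'}, R v w → R v w' → w = w'
  left_unique : ∀ {v v' w}, R v w → R v' w → v = v'
  smul : ∀ {v w} (g : G), R v w → R (g • v) (g • w)
  root : ∀ {v w} (i : Fin k), R v w → (v ∈ X.root i ↔ w ∈ Y.root i)
  adj : ∀ {v v' w w'}, R v w → R v' w' → (X.graph.Adj v v' ↔ Y.graph.Adj w w')
  face : ∀ (s : Finset X.V) (e : X.V ≃ Y.V), (∀ v ∈ s, R v (e v)) →
    (s.map e.toEmbedding ∈ Y.K.faces ↔ s ∈ X.K.faces)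

lemma exists_ballMatch {X Y : RootedComplex G D k} {r : ℕ} (h : (X.ball r).IsIso (Y.ball r)) :
    ∃ R, BallMatch X Y r R := by
  classical
  obtain ⟨e, h1, h2, h3⟩ := h
  change X.ballSet r ≃ Y.ballSet r at e
  have hface : ∀ (s : Finset X.V) (f : X.V → Y.V)
      (_ : ∀ v ∈ s, ∃ hv : v ∈ X.ballSet r, (e ⟨v, hv⟩ : Y.V) = f v),
      (s.image f ∈ Y.K.faces ↔ s ∈ X.K.faces) := by
    intro s f hs
    obtain ⟨t, rfl⟩ := X.exists_map_subtype_eq (X.ballSet r) (s := s) fun v hv => (hs v hv).1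
    have := h2 t
    change Finset.map (Function.Embedding.subtype (· ∈ Y.ballSet r)) (t.map e.toEmbedding) ∈
      Y.K.faces ↔ t.map (Function.Embedding.subtype (· ∈ X.ballSet r)) ∈ X.K.faces at this
    rw [← this]
    refine iff_of_eq (congrArg (· ∈ Y.K.faces) ?_)
    rw [Finset.map_map, Finset.map_eq_image, Finset.map_eq_image, Finset.image_image]
    refine Finset.image_congr fun v hv => ?_
    obtain ⟨_, h⟩ := hs v (Finset.mem_map_of_mem (Function.Embedding.subtype _) hv)
    exact h.symm
  have hroot : ∀ (v : X.ballSet r) (i : Fin k), (v : X.V) ∈ X.root i ↔ (e v : Y.V) ∈ Y.root i := by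
    intro v i
    have := h3 i
    constructor
    · intro hv
      exact this.subset ⟨v, hv, rfl⟩
    · intro hv
      obtain ⟨v', hv', hh⟩ := this.superset (show e v ∈ _ from hv)
      rwa [← e.injective hh]
  refine ⟨fun v w => ∃ hv : v ∈ X.ballSet r, (e ⟨v, hv⟩ : Y.V) = w, ?_, ?_, ?_, ?_, ?_, ?_, ?_, ?_⟩
  · exact fun v hv => ⟨_, hv, rfl⟩
  · intro w hw
    refine ⟨e.symm ⟨w, hw⟩, (e.symm ⟨w, hw⟩).2, ?_⟩
    simp
  · rintro v w w' ⟨_, rfl⟩ ⟨_, rfl⟩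
    rfl
  · rintro v v' w ⟨_, rfl⟩ ⟨_, hw⟩
    exact congrArg Subtype.val (e.injective (Subtype.ext hw)).symm
  · rintro v w g ⟨hv, rfl⟩
    exact ⟨(X.ballSet r).smul_mem g hv, congrArg Subtype.val (h1 g ⟨v, hv⟩)⟩
  · rintro v w i ⟨hv, rfl⟩
    exact hroot ⟨v, hv⟩ i
  · rintro v v' w w' ⟨hv, hw⟩ ⟨hv', hw'⟩
    by_cases hvv : v = v'
    · subst hvv
      subst hw
      subst hw'
      simp
    · have hww : w ≠ w' := by
        rintro rfl
        exact hvv (congrArg Subtype.val (e.injective (Subtype.ext (hw.trans hw'.symm))))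
      rw [X.pair_mem_faces_iff hvv, Y.pair_mem_faces_iff hww,
        ← hface {v, v'} (fun z => if z = v then w else w')]
      · simp [Finset.image_insert, Ne.symm hvv]
      · intro z hz
        simp only [Finset.mem_insert, Finset.mem_singleton] at hz
        rcases hz with rfl | rfl
        · simpa using ⟨hv, hw⟩
        · rw [if_neg (Ne.symm hvv)]
          exact ⟨hv', hw'⟩
  · intro s f hs
    rw [Finset.map_eq_image]
    exact hface s f hs

lemma BallMatch.swap {X Y : RootedComplex G D k} {r : ℕ} {R : X.V → Y.V → Prop}
    (h : BallMatch X Y r R) : BallMatch Y X r (fun w v => R v w) where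
  left_total := h.right_total
  right_total := h.left_total
  right_unique := h.left_unique
  left_unique := h.right_unique
  smul := h.smul
  root i hR := (h.root i hR).symm
  adj h1 h2 := (h.adj h1 h2).symm
  face s e hs := by
    rw [← h.face (s.map e.toEmbedding) e.symm.symm.symm]
    · rw [Finset.map_map]
      have : e.toEmbedding.trans e.symm.toEmbedding = Function.Embedding.refl _ := by
        ext x; simp
      simp [this]
    · intro v hv
      obtain ⟨w, hw, rfl⟩ := Finset.mem_map.1 hv
      simpa using hs w hw

/-- A matching of balls does not increase the distance to the roots. -/
lemma BallMatch.mem_ballSet {X Y : RootedComplex G D k} {r : ℕ} {R : X.V → Y.V → Prop}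
    (h : BallMatch X Y r R) {i : Fin k} {a v : X.V} (p : X.graph.Walk v a) (ha : a ∈ X.root i)
    (hp : p.length ≤ r) : ∀ w, R v w → w ∈ Y.ballSet p.length := by
  induction p with
  | nil => exact fun w hw => Y.root_subset_ballSet ((h.root i hw).1 ha) _
  | @cons v b a hvb p ih =>
    intro w hw
    rw [SimpleGraph.Walk.length_cons] at hp ⊢
    have hb : b ∈ X.ballSet r := by
      refine RootedComplex.mem_ballSet.2 ⟨i, a, ha, ?_⟩
      rw [SimpleGraph.edist_comm]
      exact (SimpleGraph.edist_le p).trans (by exact_mod_cast (Nat.le_succ _).trans hp)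
    obtain ⟨b', hb'⟩ := h.left_total b hb
    exact Y.adj_mem_ballSet (ih ha ((Nat.le_succ _).trans hp) b' hb') ((h.adj hb' hw).1 hvb.symm)

/-- The image of a vertex `v` under matchings of growing balls stays within a fixed finite ball, hence
it is eventually constant along an ultrafilter. -/
lemma BallMatch.eventually_limit [Finite G] {X Y : RootedComplex G D 1} {r : ℕ → ℕ}
    (hr : ∀ n, n ≤ r n) {R : ℕ → X.V → Y.V → Prop} (h : ∀ n, BallMatch X Y (r n) (R n))
    (U : Ultrafilter ℕ) (hU : (U : Filter ℕ) ≤ atTop) (v : X.V) : ∃ w, ∀ᶠ n in U, R n v w := by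
  obtain ⟨a, ha, hav⟩ := X.isRooted.touch 0 v
  obtain ⟨p⟩ := hav.symm
  have hfin := Y.finite_ballSet p.length
  have : ∀ᶠ n in U, ∃ w ∈ (Y.ballSet p.length : Set Y.V), R n v w := by
    filter_upwards [hU (eventually_ge_atTop p.length)] with n hn
    have hn' : p.length ≤ r n := le_trans hn (hr n)
    have hv : v ∈ X.ballSet (r n) := by
      refine RootedComplex.mem_ballSet.2 ⟨0, a, ha, ?_⟩
      rw [SimpleGraph.edist_comm]
      exact (SimpleGraph.edist_le p).trans (by exact_mod_cast hn')
    obtain ⟨w, hw⟩ := (h n).left_total v hv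
    exact ⟨w, (h n).mem_ballSet p ha hn' w hw, hw⟩
  obtain ⟨w, _, hw⟩ := (Ultrafilter.eventually_exists_mem_iff hfin).1 this
  exact ⟨w, hw⟩

/-- Rooted complexes with isomorphic balls of arbitrarily large radius are isomorphic. Since balls
are finite, the isomorphisms converge pointwise along an ultrafilter. -/
lemma isIso_of_ball_isIso [Finite G] {X Y : RootedComplex G D 1}
    (h : ∀ n, ∃ r, n ≤ r ∧ (X.ball r).IsIso (Y.ball r)) :
    X.toMarkedComplex.IsIso Y.toMarkedComplex := by
  choose r hr hiso using h
  choose R hR using fun n => exists_ballMatch (hiso n)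
  let U : Ultrafilter ℕ := hyperfilter ℕ
  have hU : (U : Filter ℕ) ≤ atTop := by
    rw [← Nat.cofinite_eq_atTop]
    exact hyperfilter_le_cofinite
  choose f hf using BallMatch.eventually_limit hr hR U hU
  choose f' hf' using BallMatch.eventually_limit hr (fun n => (hR n).swap) U hU
  let e : X.V ≃ Y.V :=
    { toFun := f
      invFun := f'
      left_inv := fun v => by
        obtain ⟨n, h1, h2⟩ := ((hf v).and (hf' (f v))).exists
        exact (hR n).left_unique h2 h1
      right_inv := fun w => by
        obtain ⟨n, h1, h2⟩ := ((hf' w).and (hf (f' w))).exists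
        exact (hR n).right_unique h2 h1 }
  refine ⟨e, fun g v => ?_, fun s => ?_, fun i => ?_⟩
  · obtain ⟨n, h1, h2⟩ := ((hf v).and (hf (g • v))).exists
    exact (hR n).right_unique h2 ((hR n).smul g h1)
  · obtain ⟨n, hn⟩ := (((s.eventually_all (l := (U : Filter ℕ)))).2 fun v _ => hf v).exists
    exact (hR n).face s e hn
  · ext w
    obtain ⟨n, hn⟩ := (hf' w).exists
    rw [e.image_eq_preimage_symm]
    exact (hR n).root i hn

end RootedComplex

namespace RootedSpace

variable {G : Type u} [Group G] {D : ℕ}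

lemma eq_of_dist_eq_zero [Finite G] {x y : RootedSpace G D 1} (h : dist x y = 0) : x = y := by
  obtain ⟨X, rfl⟩ := Quotient.exists_rep x
  obtain ⟨Y, rfl⟩ := Quotient.exists_rep y
  refine Quotient.sound (RootedComplex.isIso_of_ball_isIso fun n => ?_)
  have hlt : dist (Quotient.mk _ X : RootedSpace G D 1) (Quotient.mk _ Y) < (2 ^ n)⁻¹ := by
    rw [h]
    simp
  simp only [dist, iInf_lt_iff] at hlt
  obtain ⟨r, hr, hlt⟩ := hlt
  refine ⟨r, ?_, hr⟩
  by_contra! hn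
  refine absurd hlt (not_lt.2 (ENNReal.inv_le_inv.2 ?_))
  exact pow_le_pow_right₀ (by norm_num) hn.le

/-- Points of the space of rooted complexes are closed. -/
instance [Finite G] : MeasurableSingletonClass (RootedSpace G D 1) where
  measurableSet_singleton x := by
    refine IsClosed.measurableSet ⟨fun y hy => ⟨dist y x, ?_, ?_⟩⟩
    · exact pos_iff_ne_zero.2 fun h => hy (eq_of_dist_eq_zero h)
    · rintro z hz rfl
      exact lt_irrefl _ hz

lemma dist_le_of_ballIso {k r : ℕ} {x y : RootedSpace G D k} (h : BallIso r x y) :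
    dist x y ≤ (2 ^ r)⁻¹ :=
  iInf₂_le r h

/-- An open set contains with a point all points that agree with it on a large ball. -/
lemma exists_ballIso_mem {k : ℕ} {U : Set (RootedSpace G D k)} (hU : IsOpen U)
    {x : RootedSpace G D k} (hx : x ∈ U) : ∃ n, ∀ r, n ≤ r → ∀ y, BallIso r x y → y ∈ U := by
  obtain ⟨ε, hε, h⟩ := hU x hx
  obtain ⟨n, hn⟩ := ENNReal.exists_inv_two_pow_lt hε.ne'
  refine ⟨n, fun r hr y hy => h y (lt_of_le_of_lt ((dist_le_of_ballIso hy).trans ?_) hn)⟩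
  rw [← ENNReal.inv_pow]
  exact ENNReal.inv_le_inv.2 (pow_le_pow_right₀ (by norm_num) hr)

end RootedSpace

/-! ### Averaging over the orbits of a group action -/

/-- A weight for the action of `Λ` on `V`: a function `θ` on `V` whose sum along each orbit map
`Λ → V` is `1`. Summing a `Λ`-invariant function against `θ` amounts to summing it over the orbits
of `Λ`, where an orbit counts with the inverse of the order of its stabilizers. -/
def IsWeight (Λ : Type*) {V : Type*} [Group Λ] [MulAction Λ V] (θ : V → ℝ≥0∞) : Prop :=
  ∀ x, ∑' l : Λ, θ (l • x) = 1

namespace IsWeight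

variable {Λ V : Type*} [Group Λ] [MulAction Λ V] {θ θ' : V → ℝ≥0∞}

/-- The mass transport principle. -/
lemma mass_transport (h : IsWeight Λ θ) (h' : IsWeight Λ θ') {Ψ : V → V → ℝ≥0∞}
    (hΨ : ∀ (l : Λ) x y, Ψ (l • x) (l • y) = Ψ x y) :
    ∑' x, θ x * ∑' y, Ψ x y = ∑' y, θ' y * ∑' x, Ψ x y := by
  have key : ∀ l : Λ, ∑' x, ∑' y, θ x * Ψ x y * θ' (l • y) =
      ∑' x, ∑' y, θ (l⁻¹ • x) * Ψ x y * θ' y := by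
    intro l
    rw [← (MulAction.toPerm l⁻¹).tsum_eq]
    refine tsum_congr fun x => ?_
    rw [← (MulAction.toPerm l⁻¹).tsum_eq]
    refine tsum_congr fun y => ?_
    simp [hΨ]
  calc ∑' x, θ x * ∑' y, Ψ x y
      = ∑' x, ∑' y, ∑' l : Λ, θ x * Ψ x y * θ' (l • y) := by
        refine tsum_congr fun x => ?_
        rw [← ENNReal.tsum_mul_left]
        refine tsum_congr fun y => ?_
        rw [ENNReal.tsum_mul_left, h' y, mul_one]
    _ = ∑' l : Λ, ∑' x, ∑' y, θ x * Ψ x y * θ' (l • y) := by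
        rw [ENNReal.tsum_comm (α := Λ)]
        refine tsum_congr fun x => ?_
        rw [ENNReal.tsum_comm]
    _ = ∑' l : Λ, ∑' x, ∑' y, θ (l⁻¹ • x) * Ψ x y * θ' y := tsum_congr key
    _ = ∑' x, ∑' y, ∑' l : Λ, θ (l⁻¹ • x) * Ψ x y * θ' y := by
        rw [ENNReal.tsum_comm (α := Λ)]
        refine tsum_congr fun x => ?_
        rw [ENNReal.tsum_comm]
    _ = ∑' x, ∑' y, Ψ x y * θ' y := by
        refine tsum_congr fun x => tsum_congr fun y => ?_
        have hinv : ∑' l : Λ, θ (l⁻¹ • x) = 1 :=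
          ((Equiv.inv Λ).tsum_eq (fun l => θ (l • x))).trans (h x)
        rw [ENNReal.tsum_mul_right, ENNReal.tsum_mul_right, hinv, one_mul]
    _ = ∑' y, θ' y * ∑' x, Ψ x y := by
        rw [ENNReal.tsum_comm]
        refine tsum_congr fun y => ?_
        rw [ENNReal.tsum_mul_right, mul_comm]

lemma tsum_eq (h : IsWeight Λ θ) (h' : IsWeight Λ θ') {φ : V → ℝ≥0∞}
    (hφ : ∀ (l : Λ) x, φ (l • x) = φ x) : ∑' x, θ x * φ x = ∑' x, θ' x * φ x := by
  classical
  have := h.mass_transport h' (Ψ := fun x y => if x = y then φ x else 0) (by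
    intro l x y
    simp [hφ])
  simpa [tsum_ite_eq, eq_comm] using this

/-- Summing a weight over coset representatives gives a weight for a subgroup. -/
lemma exists_subgroup (h : IsWeight Λ θ) (L : Subgroup Λ) :
    ∃ θ' : V → ℝ≥0∞, IsWeight L θ' ∧ ∀ φ : V → ℝ≥0∞, (∀ (l : Λ) x, φ (l • x) = φ x) →
      ∑' x, θ' x * φ x = ENat.card (Λ ⧸ L) * ∑' x, θ x * φ x := by
  have hbij : Function.Bijective fun p : L × (Λ ⧸ L) => p.2.out * (p.1 : Λ) := by
    constructor
    · rintro ⟨l, q⟩ ⟨l', q'⟩ h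
      have hq : q = q' := by
        have := congrArg (QuotientGroup.mk (s := L)) h
        simpa using this
      subst hq
      exact Prod.ext (Subtype.ext (mul_left_cancel h)) rfl
    · intro l
      refine ⟨⟨⟨(l : Λ ⧸ L).out⁻¹ * l, ?_⟩, l⟩, by simp⟩
      rw [← QuotientGroup.eq, QuotientGroup.out_eq']
  refine ⟨fun x => ∑' q : Λ ⧸ L, θ (q.out • x), fun x => ?_, fun φ hφ => ?_⟩
  · rw [← h x, ← ENNReal.tsum_prod,
      ← (Equiv.ofBijective _ hbij).tsum_eq]
    exact tsum_congr fun p => congrArg θ (mul_smul p.2.out (p.1 : Λ) x).symm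
  · calc ∑' x, (∑' q : Λ ⧸ L, θ (q.out • x)) * φ x
        = ∑' q : Λ ⧸ L, ∑' x, θ (q.out • x) * φ x := by
          simp_rw [← ENNReal.tsum_mul_right]
          rw [ENNReal.tsum_comm]
      _ = ∑' q : Λ ⧸ L, ∑' x, θ x * φ x := by
          refine tsum_congr fun q => ?_
          rw [← (MulAction.toPerm q.out).tsum_eq (fun x => θ x * φ x)]
          exact tsum_congr fun x => by simp [hφ]
      _ = _ := by rw [ENNReal.tsum_const]

/-- A fundamental domain with inverse stabilizer orders is a weight. -/
lemma of_fundamentalDomain (F : Set V) [DecidablePred (· ∈ F)]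
    (hF : ∀ x : V, ∃! y, y ∈ F ∧ y ∈ MulAction.orbit Λ x)
    (hfin : ∀ x : V, Finite (MulAction.stabilizer Λ x)) :
    IsWeight Λ (fun x : V => if x ∈ F then (Nat.card (MulAction.stabilizer Λ x) : ℝ≥0∞)⁻¹ else 0) := by
  classical
  intro x
  obtain ⟨y, ⟨hy, l₀, rfl⟩, huniq⟩ := hF x
  rw [← (Equiv.mulRight l₀).tsum_eq]
  have : ∀ l : Λ, (if (Equiv.mulRight l₀ l) • x ∈ F then
      (Nat.card (MulAction.stabilizer Λ ((Equiv.mulRight l₀ l) • x)) : ℝ≥0∞)⁻¹ else 0) =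
      Set.indicator (MulAction.stabilizer Λ (l₀ • x) : Set Λ)
        (fun _ => (Nat.card (MulAction.stabilizer Λ (l₀ • x)) : ℝ≥0∞)⁻¹) l := by
    intro l
    rw [Equiv.coe_mulRight, mul_smul, Set.indicator_apply]
    by_cases hl : l • l₀ • x = l₀ • x
    · rw [if_pos (by simpa [hl] using hy), hl,
        if_pos (show l ∈ (MulAction.stabilizer Λ (l₀ • x) : Set Λ) from hl)]
    · rw [if_neg, if_neg (show l ∉ (MulAction.stabilizer Λ (l₀ • x) : Set Λ) from hl)]
      intro hmem
      exact hl (huniq _ ⟨hmem, l * l₀, mul_smul _ _ _⟩)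
  rw [tsum_congr this, ← tsum_subtype, ENNReal.tsum_const]
  have := hfin (l₀ • x)
  have hpos : Nat.card (MulAction.stabilizer Λ (l₀ • x)) ≠ 0 := Nat.card_pos.ne'
  change (ENat.card (MulAction.stabilizer Λ (l₀ • x)) : ℝ≥0∞) *
    (Nat.card (MulAction.stabilizer Λ (l₀ • x)) : ℝ≥0∞)⁻¹ = 1
  rw [ENat.card_eq_coe_natCard]
  refine ENNReal.mul_inv_cancel ?_ ?_
  · exact_mod_cast hpos
  · simp

end IsWeight

/-- The average of an invariant function over the orbits does not depend on the group. -/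
lemma IsWeight.tsum_mul_comm {Γ V : Type*} [Group Γ] [MulAction Γ V] {A B : Subgroup Γ}
    [A.FiniteIndex] [B.FiniteIndex] {θ θ' : V → ℝ≥0∞} (h : IsWeight A θ) (h' : IsWeight B θ')
    {φ : V → ℝ≥0∞} (hA : ∀ a ∈ A, ∀ x, φ (a • x) = φ x) (hB : ∀ b ∈ B, ∀ x, φ (b • x) = φ x) :
    (∑' x, θ x * φ x) * ∑' x, θ' x = (∑' x, θ' x * φ x) * ∑' x, θ x := by
  have conv : ∀ {A : Subgroup Γ} (hA : A ⊓ B ≤ A) {θ : V → ℝ≥0∞},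
      IsWeight ((A ⊓ B).subgroupOf A) θ → IsWeight (A ⊓ B : Subgroup Γ) θ := by
    intro A hA θ hθ x
    rw [← hθ x, ← (Subgroup.subgroupOfEquivOfLe hA).toEquiv.tsum_eq]
    rfl
  have conv' : ∀ {θ : V → ℝ≥0∞},
      IsWeight ((A ⊓ B).subgroupOf B) θ → IsWeight (A ⊓ B : Subgroup Γ) θ := by
    intro θ hθ x
    rw [← hθ x, ← (Subgroup.subgroupOfEquivOfLe (inf_le_right : A ⊓ B ≤ B)).toEquiv.tsum_eq]
    rfl
  obtain ⟨θ₁, h₁, H₁⟩ := h.exists_subgroup ((A ⊓ B).subgroupOf A)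
  obtain ⟨θ₂, h₂, H₂⟩ := h'.exists_subgroup ((A ⊓ B).subgroupOf B)
  -- both sides become sums for `A ⊓ B` when multiplied by the index of `A ⊓ B`, which is finite
  have hcard : ∀ (C : Subgroup Γ), (ENat.card (C ⧸ (A ⊓ B).subgroupOf C) : ℝ≥0∞) ≠ 0 ∧
      (ENat.card (C ⧸ (A ⊓ B).subgroupOf C) : ℝ≥0∞) ≠ ⊤ := by
    intro C
    have : Finite (C ⧸ (A ⊓ B).subgroupOf C) := inferInstance
    rw [ENat.card_eq_coe_natCard]
    constructor
    · simpa using Nat.card_pos.ne'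
    · simp
  have e1 : ∀ φ : V → ℝ≥0∞, (∀ a ∈ A, ∀ x, φ (a • x) = φ x) → (∀ b ∈ B, ∀ x, φ (b • x) = φ x) →
      ENat.card (A ⧸ (A ⊓ B).subgroupOf A) * ∑' x, θ x * φ x =
        (ENat.card (B ⧸ (A ⊓ B).subgroupOf B) : ℝ≥0∞) * ∑' x, θ' x * φ x := by
    intro φ hA hB
    rw [← H₁ φ fun a x => hA a a.2 x, ← H₂ φ fun b x => hB b b.2 x]
    exact (conv inf_le_left h₁).tsum_eq (conv' h₂) fun l x => hA l l.2.1 x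
  have E1 := e1 φ hA hB
  have E2 := e1 (fun _ => 1) (fun _ _ _ => rfl) (fun _ _ _ => rfl)
  simp only [mul_one] at E2
  obtain ⟨a0, a1⟩ := hcard A
  obtain ⟨b0, b1⟩ := hcard B
  set a : ℝ≥0∞ := ((ENat.card (A ⧸ (A ⊓ B).subgroupOf A) : ℕ∞) : ℝ≥0∞)
  set b : ℝ≥0∞ := ((ENat.card (B ⧸ (A ⊓ B).subgroupOf B) : ℕ∞) : ℝ≥0∞)
  rw [← ENNReal.mul_right_inj (mul_ne_zero a0 b0) (ENNReal.mul_ne_top a1 b1)]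
  calc a * b * ((∑' x, θ x * φ x) * ∑' x, θ' x)
      = (a * ∑' x, θ x * φ x) * (b * ∑' x, θ' x) := by ring
    _ = (b * ∑' x, θ' x * φ x) * (a * ∑' x, θ x) := by rw [E1, E2]
    _ = _ := by ring

/-! ### Components and their markings -/

namespace GComplex

variable {G : Type u} [Group G]

/-- The full subcomplex on `S`, with the traces on `S` of the orbits of given vertices as
distinguished sets. -/
def marked (X : GComplex G) (S : SubMulAction G X.V) {k : ℕ} (p : Fin k → X.V) :
    MarkedComplex G k :=
  { X.full S with root := fun i => {v | v.1 ∈ MulAction.orbit G (p i)} }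

/-- A `G`-equivariant symmetry of the complex identifies a marked full subcomplex with its image. -/
lemma marked_isIso (X : GComplex G) (e : X.V ≃ X.V) (he : ∀ (g : G) v, e (g • v) = g • e v)
    (hface : ∀ s : Finset X.V, s.map e.toEmbedding ∈ X.K.faces ↔ s ∈ X.K.faces)
    {S S' : SubMulAction G X.V} (hS : ∀ v, v ∈ S ↔ e v ∈ S') {k : ℕ} (p : Fin k → X.V) :
    (X.marked S p).IsIso (X.marked S' (e ∘ p)) := by
  have horb : ∀ i v, v ∈ MulAction.orbit G (p i) ↔ e v ∈ MulAction.orbit G (e (p i)) := by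
    intro i v
    rw [← RootedSpace.image_orbit e he, e.injective.mem_set_image]
  refine ⟨e.subtypeEquiv hS, fun g v => Subtype.ext (he g v.1), fun s => ?_, fun i => ?_⟩
  · change Finset.map _ _ ∈ X.K.faces ↔ Finset.map _ _ ∈ X.K.faces
    rw [← hface (s.map (Function.Embedding.subtype (· ∈ S)))]
    refine iff_of_eq (congrArg (· ∈ X.K.faces) ?_)
    exact (Finset.map_map (e.subtypeEquiv hS).toEmbedding
      (Function.Embedding.subtype (· ∈ S')) s).trans
      (Finset.map_map (Function.Embedding.subtype (· ∈ S)) e.toEmbedding s).symm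
  · ext v
    constructor
    · rintro ⟨v, hv, rfl⟩
      exact (horb i v.1).1 hv
    · intro hv
      obtain ⟨v, rfl⟩ := (e.subtypeEquiv hS).surjective v
      exact ⟨v, (horb i v.1).2 hv, rfl⟩

/-- Lying in each other's component is an equivalence relation, as `G` permutes components. -/
lemma component_eq {X : GComplex G} {x y : X.V} (h : y ∈ X.component x) :
    X.component y = X.component x := by
  obtain ⟨g, hg⟩ := mem_component.1 h
  ext v
  constructor
  · rintro ⟨c, hc⟩
    refine ⟨c * g, ?_⟩
    rw [mul_smul]
    exact (X.reachable_smul c hg).trans hc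
  · rintro ⟨c, hc⟩
    refine ⟨c * g⁻¹, ?_⟩
    have := X.reachable_smul (c * g⁻¹) hg
    rw [smul_smul, inv_mul_cancel_right] at this
    exact this.symm.trans hc

lemma mem_component_comm {X : GComplex G} {x y : X.V} :
    y ∈ X.component x ↔ x ∈ X.component y :=
  ⟨fun h => component_eq h ▸ X.self_mem_component x,
    fun h => component_eq h ▸ X.self_mem_component y⟩

/-! ### Symmetries commuting with the acting group -/

variable {H : Type u} [Group H] (K : GComplex G) (f : H →* G)

lemma smul_comm_of_commute {c d : G} (h : Commute c d) (v : K.V) : c • d • v = d • c • v := by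
  rw [smul_smul, smul_smul, h.eq]

lemma map_toPerm_mem_faces_iff (g : G) (s : Finset K.V) :
    s.map (MulAction.toPerm g).toEmbedding ∈ K.K.faces ↔ s ∈ K.K.faces := by
  refine ⟨fun h => ?_, K.smul_mem g s⟩
  have := K.smul_mem g⁻¹ _ h
  rw [Finset.map_map] at this
  convert this
  have : (MulAction.toPerm g : Equiv.Perm K.V).toEmbedding.trans
      (MulAction.toPerm g⁻¹ : Equiv.Perm K.V).toEmbedding = Function.Embedding.refl _ := by
    ext x
    simp
  rw [this, Finset.map_refl]

lemma mem_component_smul_iff {c : G} (hc : ∀ h, Commute c (f h)) {x v : (K.restrict f).V} :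
    v ∈ (K.restrict f).component x ↔
      (MulAction.toPerm c : Equiv.Perm K.V) v ∈
        (K.restrict f).component ((MulAction.toPerm c : Equiv.Perm K.V) x) := by
  have key : ∀ (c : G) (_ : ∀ h, Commute c (f h)) (x v : K.V), v ∈ (K.restrict f).component x →
      c • v ∈ (K.restrict f).component (c • x : K.V) := by
    rintro c hc x v ⟨h, hh⟩
    refine ⟨h, ?_⟩
    have := K.reachable_smul c (show K.graph.Reachable (f h • x) v from hh)
    rw [smul_smul, (hc h).eq, mul_smul] at this
    exact this
  refine ⟨key c hc x v, fun h => ?_⟩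
  have := key c⁻¹ (fun h => (hc h).inv_left) _ _ h
  have hinv : ∀ z : K.V, c⁻¹ • c • z = z := inv_smul_smul c
  exact hinv v ▸ hinv x ▸ this

lemma marked_smul_isIso {c : G} (hc : ∀ h, Commute c (f h)) (x : K.V) {k : ℕ}
    (p : Fin k → K.V) :
    ((K.restrict f).marked ((K.restrict f).component x) p).IsIso
      ((K.restrict f).marked ((K.restrict f).component (c • x : K.V)) (fun i => c • p i)) :=
  marked_isIso (K.restrict f) (MulAction.toPerm c : Equiv.Perm K.V)
    (fun h v => by
      exact smul_comm_of_commute K (hc h) v)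
    (K.map_toPerm_mem_faces_iff c) (fun _ => K.mem_component_smul_iff f hc) p

/-- The point `[K, Hx]` does not change if `x` is moved by an element commuting with the action of
`H`. -/
lemma pt_smul {D : ℕ} (hD : K.DegLE D) {c : G} (hc : ∀ h, Commute c (f h)) (x : K.V) :
    (K.restrict f).pt (restrict_degLE hD f) (c • x : K.V) =
      (K.restrict f).pt (restrict_degLE hD f) x :=
  (Quotient.sound (K.marked_smul_isIso f hc x fun _ : Fin 1 => x)).symm

end GComplex

/-! ### Mass transport on induced complexes -/

namespace RootedSpace

open GComplex

variable {G : Type u} [Group G] {H : Subgroup G} {D : ℕ}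

/-- `G ×_H Y` consists of `[G : H]` copies of `Y`. -/
lemma tsum_indSet {Y : Type u} [MulAction H Y] (F : IndSet H Y → ℝ≥0∞) (F₀ : Y → ℝ≥0∞)
    (hF : ∀ g y, F (inc H Y g y) = F₀ y) :
    ∑' p, F p = ENat.card (G ⧸ H) * ∑' y, F₀ y := by
  have hbij : Function.Bijective fun p : (G ⧸ H) × Y => inc H Y p.1.out p.2 := by
    constructor
    · rintro ⟨q, y⟩ ⟨q', y'⟩ h
      obtain ⟨c, hc, hy⟩ := inc_eq_iff.1 h
      have hq : q = q' := by
        have := congrArg (QuotientGroup.mk (s := H)) hc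
        simpa using this.symm
      subst hq
      have hc1 : c = 1 := by simpa using hc
      subst hc1
      simpa using hy.symm
    · intro p
      obtain ⟨g, y, rfl⟩ := inc_surj p
      have hmem : (g : G ⧸ H).out⁻¹ * g ∈ H := by
        rw [← QuotientGroup.eq, QuotientGroup.out_eq']
      refine ⟨⟨g, (⟨_, hmem⟩ : H) • y⟩, ?_⟩
      change inc H Y _ _ = _
      rw [← inc_mul]
      simp
  have hF' : ∀ p : (G ⧸ H) × Y, F (Equiv.ofBijective _ hbij p) = F₀ p.2 := fun p => hF _ _
  rw [← (Equiv.ofBijective _ hbij).tsum_eq, tsum_congr hF',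
    ENNReal.tsum_prod (f := fun _ y => F₀ y), ENNReal.tsum_const]

variable {X : GComplex H} (hX : X.DegLE D)

/-- The class of `(G ×_H K, G⌊1, x⌋, G⌊1, y⌋)`, where `K` is replaced by the union of the components
meeting `H x`. -/
def indPair {x y : X.V} (hy : y ∈ X.component x) : RootedSpace G D 2 :=
  mk (((X.rootAt hX x).ind H).outPair (inc H (X.component x) 1 ⟨y, hy⟩))

lemma orbit_inc (x y : X.V) (hy : y ∈ X.component x) :
    MulAction.orbit G (inc H (X.component x) 1 ⟨y, hy⟩) =
      {p | ∃ g : G, ∃ z ∈ {v : X.component x | v.1 ∈ MulAction.orbit H y},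
        p = g • inc H (X.component x) 1 z} := by
  ext p
  constructor
  · rintro ⟨g, rfl⟩
    exact ⟨g, _, MulAction.mem_orbit_self y, rfl⟩
  · rintro ⟨g, ⟨z, hz⟩, ⟨h, rfl⟩, rfl⟩
    refine ⟨g * h, ?_⟩
    change inc H (X.component x) (g * h * 1) ⟨y, hy⟩ =
      inc H (X.component x) (g * 1) (h • (⟨y, hy⟩ : X.component x))
    rw [mul_one, mul_one, inc_mul]

lemma isIso_of_root_eq {k : ℕ} {A : GComplex G} {a b : Fin k → Set A.V} (h : a = b) :
    MarkedComplex.IsIso ({ A with root := a } : MarkedComplex G k) { A with root := b } := by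
  subst h
  exact .refl _

lemma outPair_isIso {x y : X.V} (hy : y ∈ X.component x) :
    (((X.rootAt hX x).ind H).outPair (inc H (X.component x) 1 ⟨y, hy⟩)).toMarkedComplex.IsIso
      ((X.marked (X.component x) ![x, y]).ind H) := by
  refine isIso_of_root_eq (A := (X.full (X.component x)).ind H) ?_
  ext1 i
  fin_cases i
  · rfl
  · exact orbit_inc x y hy

lemma inPair_isIso {x y : X.V} (hy : y ∈ X.component x) :
    (((X.rootAt hX x).ind H).inPair (inc H (X.component x) 1 ⟨y, hy⟩)).toMarkedComplex.IsIso
      ((X.marked (X.component x) ![y, x]).ind H) := by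
  refine isIso_of_root_eq (A := (X.full (X.component x)).ind H) ?_
  ext1 i
  fin_cases i
  · exact orbit_inc x y hy
  · rfl

/-- Exchanging the roots `x` and `y` exchanges the classes of `(K, o, Gy)` and `(K, Gy, o)`; the union
of components is the same for both vertices. -/
lemma mk_inPair_eq {x y : X.V} (hy : y ∈ X.component x) :
    mk (((X.rootAt hX x).ind H).inPair (inc H (X.component x) 1 ⟨y, hy⟩)) =
      indPair hX (mem_component_comm.1 hy) := by
  refine Quotient.sound ((inPair_isIso hX hy).trans (.trans ?_ (outPair_isIso hX _).symm))
  rw [component_eq hy]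
  exact .refl _

open Classical in
/-- The mass `f [K, x, y]` sent from `x` to `y`, extended by zero. -/
noncomputable def transport (f : RootedSpace G D 2 → ℝ≥0) (x y : X.V) : ℝ≥0∞ :=
  if hy : y ∈ X.component x then (f (indPair hX hy) : ℝ≥0∞) else 0

lemma transport_of_mem (f : RootedSpace G D 2 → ℝ≥0) {x y : X.V} (hy : y ∈ X.component x) :
    transport hX f x y = f (indPair hX hy) :=
  dif_pos hy

lemma transport_of_notMem (f : RootedSpace G D 2 → ℝ≥0) {x y : X.V} (hy : y ∉ X.component x) :
    transport hX f x y = 0 :=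
  dif_neg hy

lemma tsum_component {S : SubMulAction H X.V} (F : S → ℝ≥0∞) (F' : X.V → ℝ≥0∞)
    (h : ∀ y (hy : y ∈ S), F ⟨y, hy⟩ = F' y) (h' : ∀ y ∉ S, F' y = 0) :
    ∑' y : S, F y = ∑' y, F' y := by
  rw [← (Subtype.val_injective (p := (· ∈ S))).tsum_eq (f := F')]
  · exact tsum_congr fun y => h y.1 y.2
  · intro y hy
    by_contra hyS
    exact hy (h' y fun hh => hyS ⟨⟨y, hh⟩, rfl⟩)

lemma outPair_inc (A : RootedComplex H D 1) (g : G) (y : A.V) :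
    (A.ind H).outPair (inc H A.V g y) = (A.ind H).outPair (inc H A.V 1 y) := by
  have : MulAction.orbit G (inc H A.V g y) = MulAction.orbit G (inc H A.V 1 y) := by
    rw [MulAction.orbit_eq_iff]
    exact ⟨g, by simp [smul_inc]⟩
  unfold RootedComplex.outPair
  simp only [RootedComplex.mk.injEq, MarkedComplex.mk.injEq, heq_eq_eq, true_and]
  exact congrArg (fun s => ![(A.ind H).root 0, s]) this

lemma inPair_inc (A : RootedComplex H D 1) (g : G) (y : A.V) :
    (A.ind H).inPair (inc H A.V g y) = (A.ind H).inPair (inc H A.V 1 y) := by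
  have : MulAction.orbit G (inc H A.V g y) = MulAction.orbit G (inc H A.V 1 y) := by
    rw [MulAction.orbit_eq_iff]
    exact ⟨g, by simp [smul_inc]⟩
  unfold RootedComplex.inPair
  simp only [RootedComplex.mk.injEq, MarkedComplex.mk.injEq, heq_eq_eq, true_and]
  exact congrArg (fun s => ![s, (A.ind H).root 0]) this

lemma massOut_ind_pt (f : RootedSpace G D 2 → ℝ≥0) (x : X.V) :
    massOut f (ind H (X.pt hX x)) = ENat.card (G ⧸ H) * ∑' y, transport hX f x y := by
  refine (tsum_indSet (H := H) (Y := X.component x) _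
    (fun y => (f (indPair hX y.2) : ℝ≥0∞)) fun g y => ?_).trans ?_
  · exact congrArg (fun A => (f (mk A) : ℝ≥0∞)) (outPair_inc (X.rootAt hX x) g y)
  · congr 1
    refine tsum_component _ _ (fun y hy => ?_) fun y hy => ?_
    · exact (transport_of_mem hX f hy).symm
    · exact transport_of_notMem hX f hy

lemma massIn_ind_pt (f : RootedSpace G D 2 → ℝ≥0) (x : X.V) :
    massIn f (ind H (X.pt hX x)) = ENat.card (G ⧸ H) * ∑' y, transport hX f y x := by
  refine (tsum_indSet (H := H) (Y := X.component x) _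
    (fun y => (f (indPair hX (mem_component_comm.1 y.2)) : ℝ≥0∞)) fun g y => ?_).trans ?_
  · rw [← mk_inPair_eq hX y.2]
    exact congrArg (fun A => (f (mk A) : ℝ≥0∞)) (inPair_inc (X.rootAt hX x) g y)
  · congr 1
    refine tsum_component _ _ (fun y hy => ?_) fun y hy => ?_
    · exact (transport_of_mem hX f (mem_component_comm.1 hy)).symm
    · exact transport_of_notMem hX f (mt mem_component_comm.2 hy)

lemma transport_smul {Γ : Type u} [Group Γ] {K : GComplex Γ} (hD : K.DegLE D) (φ : H →* Γ)
    (f : RootedSpace G D 2 → ℝ≥0) {c : Γ} (hc : ∀ h, Commute c (φ h)) (x y : K.V) :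
    transport (restrict_degLE hD φ) f (c • x : K.V) (c • y : K.V) =
      transport (restrict_degLE hD φ) f x y := by
  have hiff := K.mem_component_smul_iff φ hc (x := x) (v := y)
  by_cases hy : y ∈ (K.restrict φ).component x
  · have hy' : (c • y : K.V) ∈ (K.restrict φ).component (c • x : K.V) := hiff.1 hy
    rw [transport_of_mem _ f hy, transport_of_mem _ f hy']
    congr 2
    refine Quotient.sound ((outPair_isIso _ hy').trans (.trans ?_ (outPair_isIso _ hy).symm))
    refine MarkedComplex.ind_isIso ?_
    have hp : (fun i => c • (![x, y] : Fin 2 → K.V) i) = ![c • x, c • y] := by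
      ext i
      fin_cases i <;> rfl
    exact hp ▸ (K.marked_smul_isIso φ hc x ![x, y]).symm
  · exact (transport_of_notMem _ f (mt hiff.2 hy)).trans (transport_of_notMem _ f hy).symm

end RootedSpace

/-! ### Unimodularity of the limit law -/

namespace GComplex

open RootedSpace

variable {Γ : Type u} [Group Γ] (K : GComplex Γ) {D : ℕ} (hD : K.DegLE D) {G : Type u} [Group G]
  (H : Subgroup G) (f : H →* Γ) (Γ₀ : Subgroup Γ) (F : Finset K.V)
  (hF : K.IsFundamentalDomain Γ₀ F) (hproper : ∀ x : K.V, Finite (MulAction.stabilizer Γ x))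

open Classical in
/-- The weight of the fundamental domain `F`: the inverse order of the stabilizer on `F`. -/
noncomputable def domainWeight (x : K.V) : ℝ≥0∞ :=
  if x ∈ (F : Set K.V) then (Nat.card (MulAction.stabilizer Γ₀ x) : ℝ≥0∞)⁻¹ else 0

lemma finite_stabilizer (hproper : ∀ x : K.V, Finite (MulAction.stabilizer Γ x)) (x : K.V) : Finite (MulAction.stabilizer Γ₀ x) := by
  have := hproper x
  refine Finite.of_injective (β := MulAction.stabilizer Γ x) (fun g => ⟨(g : Γ₀), g.2⟩) ?_
  intro a b hab
  exact Subtype.ext (Subtype.ext (Subtype.mk.inj hab))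

lemma isWeight_domainWeight (hF : K.IsFundamentalDomain Γ₀ F)
    (hproper : ∀ x : K.V, Finite (MulAction.stabilizer Γ x)) : IsWeight Γ₀ (K.domainWeight Γ₀ F) := by
  classical
  have := IsWeight.of_fundamentalDomain (Λ := Γ₀) (F : Set K.V) hF
    (K.finite_stabilizer Γ₀ hproper)
  convert this using 2
  simp only [domainWeight]

lemma tsum_domainWeight (φ : K.V → ℝ≥0∞) : ∑' x, K.domainWeight Γ₀ F x * φ x =
    ∑ x ∈ F, (Nat.card (MulAction.stabilizer Γ₀ x) : ℝ≥0∞)⁻¹ * φ x := by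
  rw [tsum_eq_sum (s := F) fun x hx => by simp [domainWeight, hx]]
  exact Finset.sum_congr rfl fun x hx => by simp [domainWeight, hx]

lemma weight_eq_tsum : K.weight Γ₀ F = ∑' x, K.domainWeight Γ₀ F x := by
  simpa [weight] using (K.tsum_domainWeight Γ₀ F fun _ => 1).symm

variable [Nonempty K.V]

/-- Integration against the limit law is averaging with respect to the weight of the fundamental
domain. No measurability of `φ` is needed since the law is a finite sum of Dirac masses. -/
lemma lintegral_indLaw_orbitLaw [MeasurableSingletonClass (RootedSpace G D 1)]
    (φ : RootedSpace G D 1 → ℝ≥0∞) :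
    ∫⁻ z, φ z ∂(indLaw H (K.orbitLaw hD f Γ₀ F hF hproper) : Measure (RootedSpace G D 1)) =
      (∑' x, K.domainWeight Γ₀ F x)⁻¹ * ∑' x, K.domainWeight Γ₀ F x *
        φ (RootedSpace.ind H ((K.restrict f).pt (restrict_degLE hD f) x)) := by
  have hm : Measurable (RootedSpace.ind (D := D) H) := (continuous_ind H).measurable
  have : (indLaw H (K.orbitLaw hD f Γ₀ F hF hproper) : Measure (RootedSpace G D 1)) =
      (K.weight Γ₀ F)⁻¹ • ∑ x ∈ F, (Nat.card (MulAction.stabilizer Γ₀ x) : ℝ≥0∞)⁻¹ •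
        Measure.dirac (RootedSpace.ind H ((K.restrict f).pt (restrict_degLE hD f) x)) := by
    change Measure.map (RootedSpace.ind H) ((K.weight Γ₀ F)⁻¹ • ∑ x ∈ F, (_ : ℝ≥0∞) • Measure.dirac _) = _
    ext s hs
    rw [Measure.map_apply hm hs]
    simp only [Measure.smul_apply, Measure.coe_finsetSum, Finset.sum_apply,
      Measure.dirac_apply' _ hs, Measure.dirac_apply' _ (hm hs)]
    rfl
  rw [this, lintegral_smul_measure, lintegral_finsetSum_measure, K.tsum_domainWeight,
    K.weight_eq_tsum]
  simp_rw [lintegral_smul_measure, lintegral_dirac]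
  rfl

/-- The limit law is unimodular as soon as `Γ₀` commutes with the acting group. -/
theorem isUnimodular_indLaw_orbitLaw [Finite G] (hc : ∀ c ∈ Γ₀, ∀ h, Commute c (f h)) :
    IsUnimodular (indLaw H (K.orbitLaw hD f Γ₀ F hF hproper)) := by
  intro φ _
  rw [lintegral_indLaw_orbitLaw, lintegral_indLaw_orbitLaw]
  congr 1
  have hw := K.isWeight_domainWeight Γ₀ F hF hproper
  have key := hw.mass_transport hw (Ψ := fun x y => ENat.card (G ⧸ H) *
    transport (restrict_degLE hD f) φ x y) fun l x y => by
      rw [← transport_smul hD f φ (hc l l.2) x y]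
      rfl
  exact (tsum_congr fun x => congrArg _ ((massOut_ind_pt (restrict_degLE hD f) φ x).trans
    ENNReal.tsum_mul_left.symm)).trans (key.trans (tsum_congr fun x =>
      congrArg _ ((massIn_ind_pt (restrict_degLE hD f) φ x).trans
        ENNReal.tsum_mul_left.symm).symm))

end GComplex

/-! ### Local isomorphisms -/

namespace RootedComplex

variable {G : Type u} [Group G] {D k : ℕ}

/-- A simplicial map `Φ` which lifts simplices at every vertex restricts to an isomorphism of the
balls of radius `r`, provided that it is injective on the balls of radius `r + 1`. The larger radius
is needed because a simplex between vertices of the `r`-ball may have a lift that leaves it. -/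
lemma ball_isIso_of_injOn {A B : RootedComplex G D k} {r : ℕ} (Φ : A.V → B.V)
    (hsmul : ∀ (g : G) a, Φ (g • a) = g • Φ a)
    (hroot : ∀ i, Φ '' A.root i = B.root i)
    (hface : ∀ s ∈ A.K.faces, ∃ t ∈ B.K.faces, Φ '' s = t)
    (hlift : ∀ t ∈ B.K.faces, ∀ a, Φ a ∈ t → ∃ s ∈ A.K.faces, a ∈ s ∧ Φ '' s = t)
    (hinj : Set.InjOn Φ (A.ballSet (r + 1))) : (A.ball r).IsIso (B.ball r) := by
  classical
  replace hface : ∀ s ∈ A.K.faces, s.image Φ ∈ B.K.faces := by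
    intro s hs
    obtain ⟨t, ht, hst⟩ := hface s hs
    rw [← Finset.coe_image, Finset.coe_inj] at hst
    exact hst ▸ ht
  replace hlift : ∀ t ∈ B.K.faces, ∀ a, Φ a ∈ t → ∃ s ∈ A.K.faces, a ∈ s ∧ s.image Φ = t := by
    intro t ht a ha
    obtain ⟨s, hs, has, hst⟩ := hlift t ht a ha
    rw [← Finset.coe_image, Finset.coe_inj] at hst
    exact ⟨s, hs, has, hst⟩
  have hdown : ∀ {a b : A.V} (p : A.graph.Walk a b), B.graph.edist (Φ a) (Φ b) ≤ p.length := by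
    intro a b p
    induction p with
    | nil => simp
    | @cons a c b hac p ih =>
      have h1 : B.graph.edist (Φ a) (Φ c) ≤ 1 := by
        by_cases he : Φ a = Φ c
        · simp [he]
        · obtain ⟨_, s, hs, ha, hc⟩ := hac
          exact (SimpleGraph.edist_eq_one_iff_adj.2 (show B.graph.Adj (Φ a) (Φ c) from
            ⟨he, _, hface s hs, Finset.mem_image_of_mem _ ha, Finset.mem_image_of_mem _ hc⟩)).le
      refine (B.graph.edist_triangle (v := Φ c)).trans ((add_le_add h1 ih).trans ?_)
      rw [SimpleGraph.Walk.length_cons, add_comm]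
      push_cast
      exact le_rfl
  have hup : ∀ {b b' : B.V} (p : B.graph.Walk b b') (a : A.V), Φ a = b →
      ∃ a', Φ a' = b' ∧ A.graph.edist a a' ≤ p.length := by
    intro b b' p
    induction p with
    | nil => exact fun a ha => ⟨a, ha, by simp⟩
    | @cons b c b' hbc p ih =>
      intro a ha
      have hbc' := hbc
      obtain ⟨hne, t, ht, hb, hc⟩ := hbc'
      rw [← ha] at hb hne
      obtain ⟨s, hs, has, hst⟩ := hlift t ht a hb
      rw [← hst] at hc
      obtain ⟨d, hds, hdc⟩ := Finset.mem_image.1 hc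
      obtain ⟨a', ha', hd⟩ := ih d hdc
      have hac : A.graph.Adj a d :=
        ⟨fun h => hne (by rw [h, hdc]), s, hs, has, hds⟩
      refine ⟨a', ha', (A.graph.edist_triangle (v := d)).trans
        ((add_le_add (SimpleGraph.edist_eq_one_iff_adj.2 hac).le hd).trans ?_)⟩
      rw [SimpleGraph.Walk.length_cons, add_comm]
      push_cast
      exact le_rfl
  have hmaps : ∀ a ∈ A.ballSet r, Φ a ∈ B.ballSet r := by
    intro a ha
    obtain ⟨i, w, hw, hwa⟩ := mem_ballSet.1 ha
    obtain ⟨p, hp⟩ := GComplex.exists_walk_of_edist_le hwa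
    exact mem_ballSet.2 ⟨i, Φ w, (hroot i).subset ⟨w, hw, rfl⟩,
      (hdown p).trans (by exact_mod_cast hp)⟩
  have hsurj : ∀ b ∈ B.ballSet r, ∃ a ∈ A.ballSet r, Φ a = b := by
    intro b hb
    obtain ⟨i, w, hw, hwb⟩ := mem_ballSet.1 hb
    obtain ⟨w, hw', rfl⟩ := (hroot i).superset hw
    obtain ⟨p, hp⟩ := GComplex.exists_walk_of_edist_le hwb
    obtain ⟨a, rfl, ha⟩ := hup p w rfl
    exact ⟨a, mem_ballSet.2 ⟨i, w, hw', ha.trans (by exact_mod_cast hp)⟩, rfl⟩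
  have hinj' : Set.InjOn Φ (A.ballSet r) := hinj.mono fun a ha => A.ballSet_mono (Nat.le_succ r) ha
  let e : A.ballSet r ≃ B.ballSet r := Equiv.ofBijective (fun a => ⟨Φ a, hmaps a a.2⟩) (by
    constructor
    · intro a a' h
      exact Subtype.ext (hinj' a.2 a'.2 (congrArg Subtype.val h))
    · rintro ⟨b, hb⟩
      obtain ⟨a, ha, rfl⟩ := hsurj b hb
      exact ⟨⟨a, ha⟩, rfl⟩)
  have hmap : ∀ s : Finset (A.ballSet r), (s.map e.toEmbedding).map
      (Function.Embedding.subtype (· ∈ B.ballSet r)) =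
      (s.map (Function.Embedding.subtype (· ∈ A.ballSet r))).image Φ := by
    intro s
    rw [Finset.map_map, Finset.map_eq_image, Finset.map_eq_image, Finset.image_image]
    rfl
  refine ⟨e, fun g a => Subtype.ext (hsmul g a.1), fun s => ?_, fun i => ?_⟩
  · change Finset (A.ballSet r) at s
    change (s.map e.toEmbedding).map (Function.Embedding.subtype (· ∈ B.ballSet r)) ∈ B.K.faces ↔
      s.map (Function.Embedding.subtype (· ∈ A.ballSet r)) ∈ A.K.faces
    rw [hmap]
    have hsub : ∀ a ∈ s.map (Function.Embedding.subtype (· ∈ A.ballSet r)), a ∈ A.ballSet r := by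
      intro a ha
      obtain ⟨a, _, rfl⟩ := Finset.mem_map.1 ha
      exact a.2
    generalize s.map (Function.Embedding.subtype (· ∈ A.ballSet r)) = s at hsub
    refine ⟨fun h => ?_, hface s⟩
    obtain ⟨a, ha⟩ : s.Nonempty := by
      simpa using (B.K.isRelLowerSet_faces h).1
    obtain ⟨s', hs', has', heq⟩ := hlift _ h a (Finset.mem_image_of_mem Φ ha)
    have hs'sub : ∀ c ∈ s', c ∈ A.ballSet (r + 1) := by
      intro c hc
      by_cases hac : a = c
      · exact hac ▸ A.ballSet_mono (Nat.le_succ r) (hsub a ha)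
      · exact A.adj_mem_ballSet (hsub a ha) ⟨hac, s', hs', has', hc⟩
    have : s' = s := by
      have hsub' : ∀ c ∈ s, c ∈ A.ballSet (r + 1) := fun c hc =>
        A.ballSet_mono (Nat.le_succ r) (hsub c hc)
      have h2 := congrArg (fun t : Finset B.V => (t : Set B.V)) heq
      simp only [Finset.coe_image] at h2
      exact Finset.coe_injective ((hinj.image_eq_image_iff hs'sub hsub').1 h2)
    exact this ▸ hs'
  · ext b
    constructor
    · rintro ⟨a, ha, rfl⟩
      exact (hroot i).subset ⟨a.1, ha, rfl⟩
    · intro hb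
      obtain ⟨a, ha, hab⟩ := (hroot i).superset (show b.1 ∈ B.root i from hb)
      exact ⟨⟨a, A.root_subset_ballSet ha r⟩, ha, Subtype.ext hab⟩

end RootedComplex

/-! ### Balls in quotients -/

namespace GComplex

variable {Γ : Type u} [Group Γ] (K : GComplex Γ) (N : Subgroup Γ) [N.Normal]

/-- The projection of the vertices of `K` to those of `K / N`. -/
def proj (v : K.V) : (K.quotient N).V := Quotient.mk (MulAction.orbitRel N K.V) v

variable {K N}

lemma proj_eq_iff {v w : K.V} : K.proj N v = K.proj N w ↔ ∃ n ∈ N, n • w = v := by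
  constructor
  · intro h
    obtain ⟨n, hn⟩ : ∃ n : N, n • w = v := Quotient.exact h
    exact ⟨n, n.2, hn⟩
  · rintro ⟨n, hn, rfl⟩
    exact Quotient.sound ⟨⟨n, hn⟩, rfl⟩

lemma proj_surjective : Function.Surjective (K.proj N) := Quotient.exists_rep

lemma mem_quotient_faces {t : Finset (K.quotient N).V} :
    t ∈ (K.quotient N).K.faces ↔ ∃ s ∈ K.K.faces, K.proj N '' s = t := by
  have key : ∀ s : Finset K.V, (t : Set _) = K.proj N '' s ↔
      ∀ q, q ∈ t ↔ ∃ v ∈ s, K.proj N v = q := fun s => Set.ext_iff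
  have himage : ∀ (_ : DecidableEq (K.quotient N).V) (s : Finset K.V) (q : (K.quotient N).V),
      q ∈ s.image (K.proj N) ↔ ∃ v ∈ s, K.proj N v = q := fun _ _ _ => Finset.mem_image
  constructor
  · rintro ⟨s, hs, hst⟩
    refine ⟨s, hs, ((key s).2 fun q => ?_).symm⟩
    rw [← hst]
    exact himage _ s q
  · rintro ⟨s, hs, hst⟩
    refine ⟨s, hs, ?_⟩
    ext q
    exact (himage _ s q).trans ((key s).1 hst.symm q).symm

/-- The simplices of a full subcomplex of `K / N` are the images of the simplices of `K` whose
vertices project into it. -/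
lemma mem_full_quotient_faces {G : Type u} [Group G] (f : G →* Γ)
    {T : SubMulAction G ((K.quotient N).restrict f).V} {t : Finset T} :
    t ∈ (((K.quotient N).restrict f).full T).K.faces ↔ ∃ s ∈ K.K.faces,
      (∀ v ∈ s, (K.proj N v : ((K.quotient N).restrict f).V) ∈ T) ∧
      ∀ q : T, q ∈ t ↔ ∃ v ∈ s, K.proj N v = q.1 := by
  have hmap : ∀ q : T, q.1 ∈ t.map (Function.Embedding.subtype (· ∈ T)) ↔ q ∈ t := fun q =>
    Finset.mem_map' (Function.Embedding.subtype (· ∈ T))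
  refine (mem_quotient_faces (K := K) (N := N)
    (t := t.map (Function.Embedding.subtype (· ∈ T)))).trans ?_
  constructor
  · rintro ⟨s, hs, hst⟩
    refine ⟨s, hs, fun v hv => ?_, fun q => ?_⟩
    · obtain ⟨q, _, hqv⟩ := Finset.mem_map.1 (hst.subset ⟨v, hv, rfl⟩)
      exact hqv ▸ q.2
    · rw [← hmap]
      exact (Set.ext_iff.1 hst q.1).symm
  · rintro ⟨s, hs, hsT, hst⟩
    refine ⟨s, hs, ?_⟩
    ext q
    constructor
    · rintro ⟨v, hv, rfl⟩
      exact (hmap ⟨_, hsT v hv⟩).2 ((hst _).2 ⟨v, hv, rfl⟩)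
    · intro hq
      obtain ⟨q, hq', rfl⟩ := Finset.mem_map.1 hq
      exact (hst q).1 hq'

lemma reachable_proj {v w : K.V} (h : K.graph.Reachable v w) :
    (K.quotient N).graph.Reachable (K.proj N v) (K.proj N w) := by
  classical
  obtain ⟨p⟩ := h
  induction p with
  | nil => exact SimpleGraph.Reachable.refl _
  | @cons a b c hab p ih =>
    refine SimpleGraph.Reachable.trans ?_ ih
    by_cases he : K.proj N a = K.proj N b
    · rw [he]
    · obtain ⟨_, s, hs, ha, hb⟩ := hab
      exact SimpleGraph.Adj.reachable ⟨he, s.image (K.proj N),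
        mem_quotient_faces.2 ⟨s, hs, Finset.coe_image.symm⟩,
        Finset.mem_image_of_mem _ ha, Finset.mem_image_of_mem _ hb⟩

variable (K) in
/-- The elements which move some vertex of the ball of radius `r` around `x` into this ball. -/
def moveSet (r : ℕ) (x : K.V) : Set Γ :=
  {c | ∃ y, K.graph.edist x y ≤ r ∧ K.graph.edist x (c • y) ≤ r}

variable {G : Subgroup Γ} (H : Subgroup G) {D : ℕ} (hD : K.DegLE D)

lemma edist_of_mem_ballSet_rootAt {H : Type u} [Group H] {X : GComplex H} {D : ℕ} (hX : X.DegLE D)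
    {x : X.V} {r : ℕ} {y : X.component x} (hy : y ∈ (X.rootAt hX x).ballSet r) :
    ∃ h : H, X.graph.edist (h • x) y.1 ≤ r := by
  obtain ⟨i, w, ⟨h, hw⟩, hwy⟩ := RootedComplex.mem_ballSet.1 hy
  let ι : (X.full (X.component x)).graph →g X.graph :=
    { toFun := Subtype.val
      map_rel' := fun {a b} ⟨hne, s, hs, ha, hb⟩ => ⟨fun h => hne (Subtype.ext h), _, hs,
        Finset.mem_map_of_mem (Function.Embedding.subtype (· ∈ X.component x)) ha,
        Finset.mem_map_of_mem (Function.Embedding.subtype (· ∈ X.component x)) hb⟩ }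
  refine ⟨h, ?_⟩
  have := (edist_hom_le ι w y).trans hwy
  have hw' : h • x = ι w := hw
  rwa [hw']

/-- The balls around `x` in `K / N` are induced from balls of `K` if no element of a coset `N k`
with `k ∈ G` moves a vertex close to `x` to a vertex close to `x`, except for `k` itself when it
lies in `H`. -/
lemma ball_quotient_isIso {r : ℕ} {x : K.V}
    (hx : ∀ c ∈ K.moveSet (r + 1) x, ∀ k : G, c * (k : Γ)⁻¹ ∈ N → c = k ∧ k ∈ H) :
    ((((K.restrict (G.subtype.comp H.subtype)).rootAt (restrict_degLE hD _) x).ind H).ball r).IsIso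
      ((((K.quotient N).restrict G.subtype).rootAt
        (restrict_degLE (quotient_degLE hD N) _) (K.proj N x)).ball r) := by
  classical
  let X := K.restrict (G.subtype.comp H.subtype)
  let S := X.component x
  let Y := (K.quotient N).restrict G.subtype
  let T := Y.component (K.proj N x)
  let val : S → K.V := fun y => y.1
  have hT : ∀ (g : G) (y : S), (K.proj N ((g : Γ) • val y) : Y.V) ∈ T := by
    rintro g ⟨y, h, hy⟩
    refine ⟨g * h, ?_⟩
    have hy' : K.graph.Reachable (((h : G) : Γ) • x) y := hy
    have := reachable_proj (N := N) (K.reachable_smul (g : Γ) hy')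
    rw [smul_smul] at this
    exact this
  let Φ : IndSet H S → T := Quotient.lift
    (fun p : G × S => (⟨K.proj N ((p.1 : Γ) • val p.2), hT p.1 p.2⟩ : T)) (by
      rintro ⟨g, y⟩ _ ⟨h, rfl⟩
      refine Subtype.ext (congrArg (K.proj N) ?_)
      change (g : Γ) • val y = ((g * h : G) : Γ) • ((h⁻¹ : H) : G).1 • val y
      rw [smul_smul]
      simp)
  refine RootedComplex.ball_isIso_of_injOn Φ ?_ ?_ ?_ ?_ ?_
  · intro g p
    obtain ⟨g', y, rfl⟩ := inc_surj p
    refine Subtype.ext (congrArg (K.proj N) ?_)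
    exact mul_smul (g : Γ) (g' : Γ) (val y)
  · intro i
    ext q
    constructor
    · rintro ⟨_, ⟨g, y, ⟨h, hy⟩, rfl⟩, rfl⟩
      refine ⟨g * h, ?_⟩
      have hy' : ((h : G) : Γ) • x = val y := hy
      change K.proj N (((g * h : G) : Γ) • x) = K.proj N (((g * 1 : G) : Γ) • val y)
      rw [← hy', smul_smul]
      simp
    · rintro ⟨g, hg⟩
      refine ⟨inc H S g ⟨x, X.self_mem_component x⟩,
        ⟨g, ⟨x, X.self_mem_component x⟩, MulAction.mem_orbit_self x, ?_⟩, Subtype.ext hg⟩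
      exact congrArg (fun c => inc H S c ⟨x, X.self_mem_component x⟩) (mul_one g).symm
  · rintro _ ⟨g, s, hs, rfl⟩
    change Finset S at s
    change s.map (Function.Embedding.subtype (· ∈ S)) ∈ K.K.faces at hs
    let t : Finset T := (s.map (inc H S g)).image Φ
    have ht : ∀ q, q ∈ t ↔ ∃ y ∈ s, Φ (inc H S g y) = q := by
      intro q
      simp [t]
    refine ⟨t, (mem_full_quotient_faces G.subtype).2 ⟨_, K.smul_mem (g : Γ) _ hs, ?_, ?_⟩, ?_⟩
    · intro v hv
      obtain ⟨w, hw, rfl⟩ := Finset.mem_map.1 hv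
      obtain ⟨y, hy, rfl⟩ := Finset.mem_map.1 hw
      exact hT g y
    · intro q
      rw [ht]
      constructor
      · rintro ⟨y, hy, rfl⟩
        exact ⟨_, Finset.mem_map_of_mem _ (Finset.mem_map_of_mem _ hy), rfl⟩
      · rintro ⟨v, hv, hq⟩
        obtain ⟨w, hw, rfl⟩ := Finset.mem_map.1 hv
        obtain ⟨y, hy, rfl⟩ := Finset.mem_map.1 hw
        exact ⟨y, hy, Subtype.ext hq⟩
    · ext q
      refine Iff.trans ?_ (ht q).symm
      constructor
      · rintro ⟨p, hp, rfl⟩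
        obtain ⟨y, hy, rfl⟩ := Finset.mem_map.1 hp
        exact ⟨y, hy, rfl⟩
      · rintro ⟨y, hy, rfl⟩
        exact ⟨_, Finset.mem_map_of_mem _ hy, rfl⟩
  · intro t ht p hp
    obtain ⟨g, y, rfl⟩ := inc_surj p
    change S at y
    change Finset T at t
    obtain ⟨s, hs, hsT, hst⟩ := (mem_full_quotient_faces G.subtype).1 ht
    obtain ⟨z, hz, hzy⟩ := (hst _).1 hp
    obtain ⟨n, hn, hnz⟩ := proj_eq_iff.1 (show K.proj N ((g : Γ) • val y) = K.proj N z from hzy.symm)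
    -- the lift of `t` at `y` is the translate of `s` by `c`
    let c : Γ := (g : Γ)⁻¹ * n
    have hcz : c • z = val y := by
      rw [mul_smul, hnz, inv_smul_smul]
    have hproj : ∀ v, K.proj N ((g : Γ) • c • v) = K.proj N v := fun v =>
      proj_eq_iff.2 ⟨n, hn, by simp [c, smul_smul]⟩
    have hcs := K.smul_mem c s hs
    have hycs : val y ∈ s.map (MulAction.toPerm c : Equiv.Perm K.V).toEmbedding :=
      Finset.mem_map.2 ⟨z, hz, hcz⟩
    have hcS : ∀ v ∈ s.map (MulAction.toPerm c : Equiv.Perm K.V).toEmbedding, v ∈ S := by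
      intro v hv
      obtain ⟨h, hh⟩ := y.2
      refine ⟨h, SimpleGraph.Reachable.trans hh ?_⟩
      by_cases hyv : val y = v
      · subst hyv
        exact SimpleGraph.Reachable.refl _
      · exact SimpleGraph.Adj.reachable ⟨hyv, _, hcs, hycs, hv⟩
    obtain ⟨σ, hσ⟩ := X.exists_map_subtype_eq S hcS
    have hσ' : ∀ y : S, y ∈ σ ↔ val y ∈ s.map (MulAction.toPerm c : Equiv.Perm K.V).toEmbedding := by
      intro y
      rw [← hσ]
      exact (Finset.mem_map' (Function.Embedding.subtype (· ∈ S))).symm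
    refine ⟨σ.map (inc H S g), ⟨g, σ, ?_, rfl⟩, Finset.mem_map_of_mem _ ((hσ' y).2 hycs), ?_⟩
    · change σ.map (Function.Embedding.subtype (· ∈ S)) ∈ K.K.faces
      rw [hσ]
      exact hcs
    · ext q
      refine Iff.trans ?_ (hst q).symm
      constructor
      · rintro ⟨p, hp, rfl⟩
        obtain ⟨y, hy, rfl⟩ := Finset.mem_map.1 hp
        obtain ⟨v, hv, hvy⟩ := Finset.mem_map.1 ((hσ' y).1 hy)
        refine ⟨v, hv, (hproj v).symm.trans ?_⟩
        change _ = K.proj N ((g : Γ) • val y)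
        rw [← hvy]
        rfl
      · rintro ⟨v, hv, hvq⟩
        have hmem : c • v ∈ s.map (MulAction.toPerm c : Equiv.Perm K.V).toEmbedding :=
          Finset.mem_map.2 ⟨v, hv, rfl⟩
        refine ⟨inc H S g ⟨c • v, hcS _ hmem⟩,
          Finset.mem_map_of_mem _ ((hσ' ⟨c • v, hcS _ hmem⟩).2 hmem), Subtype.ext ?_⟩
        exact (hproj v).trans hvq
  · intro p hp q hq hpq
    obtain ⟨g, y, rfl⟩ := inc_surj p
    obtain ⟨g', y', rfl⟩ := inc_surj q
    change S at y y'
    have hpq' : K.proj N ((g : Γ) • val y) = K.proj N ((g' : Γ) • val y') :=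
      congrArg Subtype.val hpq
    obtain ⟨n, hn, hny⟩ := proj_eq_iff.1 hpq'
    obtain ⟨h, hh⟩ := edist_of_mem_ballSet_rootAt _ (RootedComplex.mem_ind_ballSet.1 hp)
    obtain ⟨h', hh'⟩ := edist_of_mem_ballSet_rootAt _ (RootedComplex.mem_ind_ballSet.1 hq)
    change K.graph.edist (((h : G) : Γ) • x) (val y) ≤ _ at hh
    change K.graph.edist (((h' : G) : Γ) • x) (val y') ≤ _ at hh'
    -- after translating both vertices to the ball around `x`, an element of `N k` moves one of them
    -- to the other
    let k : G := (h : G)⁻¹ * g⁻¹ * g' * h'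
    let c : Γ := ((h : G) : Γ)⁻¹ * (g : Γ)⁻¹ * n * (g' : Γ) * ((h' : G) : Γ)
    have hmove : ∀ (a : Γ) (z : K.V), K.graph.edist (a • x) z ≤ (r + 1 : ℕ) →
        K.graph.edist x (a⁻¹ • z) ≤ (r + 1 : ℕ) := by
      intro a z haz
      have := K.edist_smul_le a⁻¹ (a • x) z
      rw [inv_smul_smul] at this
      exact this.trans haz
    have hcy : c • (((h' : G) : Γ)⁻¹ • val y') = ((h : G) : Γ)⁻¹ • val y := by
      rw [eq_inv_smul_iff, ← inv_smul_smul (g : Γ) (val y), ← hny]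
      simp [c, smul_smul, mul_assoc]
    have hck : c * (k : Γ)⁻¹ ∈ N := by
      have := ‹N.Normal›.conj_mem n hn (((h : G) : Γ)⁻¹ * (g : Γ)⁻¹)
      convert this using 1
      simp [c, k, mul_assoc]
    obtain ⟨hc, hkH⟩ := hx c ⟨((h' : G) : Γ)⁻¹ • val y', hmove _ _ hh', hcy ▸ hmove _ _ hh⟩ k hck
    have hgg : g⁻¹ * g' ∈ H := by
      have : g⁻¹ * g' = (h : G) * k * (h' : G)⁻¹ := by simp [k, mul_assoc]
      rw [this]
      exact H.mul_mem (H.mul_mem h.2 hkH) (H.inv_mem h'.2)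
    have hn1 : n = 1 := by
      have : ((h : G) : Γ)⁻¹ * (g : Γ)⁻¹ * n * (g' : Γ) * ((h' : G) : Γ) =
          ((h : G) : Γ)⁻¹ * (g : Γ)⁻¹ * (g' : Γ) * ((h' : G) : Γ) := hc
      simpa [mul_assoc] using this
    refine inc_eq_iff.2 ⟨⟨g⁻¹ * g', hgg⟩, by simp, Subtype.ext ?_⟩
    change val y' = ((g⁻¹ * g' : G) : Γ)⁻¹ • val y
    rw [eq_inv_smul_iff, Subgroup.coe_mul, Subgroup.coe_inv, mul_smul, inv_smul_eq_iff, ← hny, hn1,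
      one_smul]

end GComplex

/-! ### Elements moving a vertex by a bounded distance -/

namespace GComplex

variable {Γ : Type u} [Group Γ] {K : GComplex Γ} {D : ℕ}

lemma finite_moveSet (hD : K.DegLE D) (hproper : ∀ x : K.V, Finite (MulAction.stabilizer Γ x))
    (r : ℕ) (x : K.V) : (K.moveSet r x).Finite := by
  have hfin : ∀ y z : K.V, {c : Γ | c • y = z}.Finite := by
    intro y z
    rcases Set.eq_empty_or_nonempty {c : Γ | c • y = z} with h | ⟨c, hc⟩
    · rw [h]
      exact Set.finite_empty
    · have := hproper y
      refine ((Set.toFinite (MulAction.stabilizer Γ y : Set Γ)).image (c * ·)).subset ?_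
      intro d hd
      refine ⟨c⁻¹ * d, ?_, by simp⟩
      change (c⁻¹ * d) • y = y
      rw [mul_smul, show d • y = z from hd, ← show c • y = z from hc, inv_smul_smul]
  have hB := finite_edist_le hD x r
  refine (hB.biUnion fun y _ => hB.biUnion fun z _ => hfin y z).subset ?_
  rintro c ⟨y, hy, hcy⟩
  exact Set.mem_biUnion hy (Set.mem_biUnion hcy rfl)

lemma conj_mem_moveSet {r : ℕ} {x : K.V} {c : Γ} (γ : Γ) (hc : c ∈ K.moveSet r (γ • x)) :
    γ⁻¹ * c * γ ∈ K.moveSet r x := by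
  have key : ∀ y, K.graph.edist (γ • x) y ≤ r → K.graph.edist x (γ⁻¹ • y) ≤ r := by
    intro y hy
    have := K.edist_smul_le γ⁻¹ (γ • x) y
    rw [inv_smul_smul] at this
    exact this.trans hy
  obtain ⟨y, hy, hcy⟩ := hc
  refine ⟨γ⁻¹ • y, key y hy, ?_⟩
  have := key _ hcy
  rwa [show (γ⁻¹ * c * γ) • γ⁻¹ • y = γ⁻¹ • c • y by simp [smul_smul, mul_assoc]]

/-- Finitely many orbits of vertices: every vertex is a translate of one in a finite set. -/
lemma exists_finite_smul_eq [Finite (MulAction.orbitRel.Quotient Γ K.V)] :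
    ∃ R : Set K.V, R.Finite ∧ ∀ x : K.V, ∃ y ∈ R, ∃ γ : Γ, γ • y = x := by
  refine ⟨Set.range (Quotient.out : MulAction.orbitRel.Quotient Γ K.V → K.V),
    Set.finite_range _, fun x => ⟨_, ⟨Quotient.mk _ x, rfl⟩, ?_⟩⟩
  obtain ⟨γ, hγ⟩ : x ∈ MulAction.orbit Γ _ :=
    (MulAction.orbitRel Γ K.V).symm (Quotient.mk_out (s := MulAction.orbitRel Γ K.V) x)
  exact ⟨γ, hγ⟩

lemma exists_ncard_moveSet_le [Finite (MulAction.orbitRel.Quotient Γ K.V)] (hD : K.DegLE D)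
    (hproper : ∀ x : K.V, Finite (MulAction.stabilizer Γ x)) (r : ℕ) :
    ∃ M : ℕ, 0 < M ∧ ∀ x, (K.moveSet r x).ncard ≤ M := by
  obtain ⟨R, hR, hR'⟩ := exists_finite_smul_eq (K := K)
  obtain ⟨M, hM⟩ := (hR.image fun x => (K.moveSet r x).ncard).bddAbove
  refine ⟨M + 1, Nat.succ_pos _, fun x => ?_⟩
  obtain ⟨y, hy, γ, rfl⟩ := hR' x
  refine le_trans ?_ ((hM ⟨y, hy, rfl⟩).trans (Nat.le_succ M))
  refine Set.ncard_le_ncard_of_injOn (fun c => γ⁻¹ * c * γ) (fun c hc => conj_mem_moveSet γ hc) ?_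
    (finite_moveSet hD hproper r y)
  intro a _ b _ h
  simpa using h

end GComplex

/-! ### Residual chains -/

section ResidualChain

variable {Γ : Type u} [Group Γ] {N : ℕ → Subgroup Γ}

/-- A finite set meets the late members of a chain with trivial intersection at most in `1`. -/
lemma eventually_eq_one_of_mem (hN : Antitone N) (hN' : ⨅ n, N n = ⊥) {S : Set Γ}
    (hS : S.Finite) : ∀ᶠ n in atTop, ∀ s ∈ S, s ∈ N n → s = 1 := by
  rw [Filter.eventually_all_finite hS]
  intro s _
  by_cases hs : s = 1
  · exact .of_forall fun _ _ => hs
  · have : ∃ n, s ∉ N n := by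
      by_contra! h
      exact hs (Subgroup.mem_bot.1 (hN' ▸ Subgroup.mem_iInf.2 h))
    obtain ⟨n, hn⟩ := this
    filter_upwards [eventually_ge_atTop n] with m hm hmem
    exact absurd (hN hm hmem) hn

variable {G : Subgroup Γ} [Finite G]

lemma finite_conjugates_fcSubgroup :
    (⋃ k ∈ fcSubgroup G, conjugatesOf (k : Γ)).Finite :=
  (Set.toFinite (fcSubgroup G : Set G)).biUnion fun _ hk => hk

/-- The commutators of `N n` with an element of finite conjugacy class lie in a finite set and in
`N n`, hence are trivial for large `n`. -/
lemma eventually_commute_fcSubgroup [hnorm : ∀ n, (N n).Normal] (hN : Antitone N)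
    (hN' : ⨅ n, N n = ⊥) :
    ∀ᶠ n in atTop, ∀ m ∈ N n, ∀ k ∈ fcSubgroup G, Commute m (k : Γ) := by
  have hfin := Set.Finite.image2 (fun a b => a * b⁻¹)
    (finite_conjugates_fcSubgroup (G := G)) (finite_conjugates_fcSubgroup (G := G))
  filter_upwards [eventually_eq_one_of_mem hN hN' hfin] with n hn m hm k hk
  have h1 : m * k * m⁻¹ * (k : Γ)⁻¹ = 1 := by
    refine hn _ ⟨_, Set.mem_biUnion hk (isConj_iff.2 ⟨m, rfl⟩), _,
      Set.mem_biUnion hk (mem_conjugatesOf_self), rfl⟩ ?_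
    have := (N n).mul_mem hm ((hnorm n).conj_mem m⁻¹ ((N n).inv_mem hm) k)
    simpa [mul_assoc] using this
  rw [mul_inv_eq_one, mul_inv_eq_iff_eq_mul] at h1
  exact h1

end ResidualChain

namespace GComplex

variable {Γ : Type u} [Group Γ] {K : GComplex Γ} {D : ℕ}

/-- Far along the chain, the coset `N k` of an element `k` with finite conjugacy class contains no
element other than `k` that moves some vertex by a bounded distance. -/
lemma eventually_eq_of_mem_moveSet [Finite (MulAction.orbitRel.Quotient Γ K.V)] (hD : K.DegLE D)
    (hproper : ∀ x : K.V, Finite (MulAction.stabilizer Γ x)) {G : Subgroup Γ} [Finite G]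
    {N : ℕ → Subgroup Γ} [hnorm : ∀ n, (N n).Normal] (hN : Antitone N) (hN' : ⨅ n, N n = ⊥)
    (r : ℕ) : ∀ᶠ n in atTop, ∀ x, ∀ c ∈ K.moveSet r x, ∀ k ∈ fcSubgroup G,
      c * (k : Γ)⁻¹ ∈ N n → c = k := by
  obtain ⟨R, hR, hR'⟩ := exists_finite_smul_eq (K := K)
  have hfin := Set.Finite.image2 (fun a b => a * b⁻¹)
    (hR.biUnion fun x _ => finite_moveSet hD hproper r x)
    (finite_conjugates_fcSubgroup (G := G))
  filter_upwards [eventually_eq_one_of_mem hN hN' hfin] with n hn x c hc k hk hck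
  obtain ⟨y, hy, γ, rfl⟩ := hR' x
  have h1 : γ⁻¹ * c * γ * (γ⁻¹ * k * γ)⁻¹ = 1 := by
    refine hn _ ⟨_, Set.mem_biUnion hy (conj_mem_moveSet γ hc), _,
      Set.mem_biUnion hk (isConj_iff.2 ⟨γ⁻¹, by simp⟩), rfl⟩ ?_
    have := (hnorm n).conj_mem _ hck γ⁻¹
    simpa [mul_assoc] using this
  simpa using mul_inv_eq_one.1 h1

/-! ### Bad vertices of the quotients -/

/-- The vertices of `K / N` some lift of which is moved by a bounded distance by an element of the
coset `N a`. -/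
def badSet (K : GComplex Γ) (N : Subgroup Γ) [N.Normal] (r : ℕ) (a : Γ) : Set (K.quotient N).V :=
  {q | ∃ x, K.proj N x = q ∧ ∃ c ∈ K.moveSet r x, c * a⁻¹ ∈ N}

variable {N : Subgroup Γ} [hN : N.Normal] {r : ℕ}

/-- Being bad does not depend on the lift of the vertex. -/
lemma exists_mem_moveSet_of_proj_mem_badSet {x : K.V} {a : Γ}
    (h : K.proj N x ∈ K.badSet N r a) : ∃ c ∈ K.moveSet r x, c * a⁻¹ ∈ N := by
  obtain ⟨y, hy, c, hc, hca⟩ := h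
  obtain ⟨n, hn, rfl⟩ := proj_eq_iff.1 hy
  refine ⟨n⁻¹ * c * n, conj_mem_moveSet n hc, ?_⟩
  have := N.mul_mem (N.mul_mem (N.inv_mem hn) (hN.conj_mem n hn c)) hca
  simpa [mul_assoc] using this

lemma smul_mem_badSet {a c : Γ} {q : (K.quotient N).V} (h : q ∈ K.badSet N r a) :
    c • q ∈ K.badSet N r (c * a * c⁻¹) := by
  obtain ⟨x, rfl, d, hd, hda⟩ := h
  refine ⟨c • x, rfl, c * d * c⁻¹, ?_, ?_⟩
  · have := conj_mem_moveSet (K := K) (r := r) (x := c • x) (c := d) c⁻¹ (by rwa [inv_smul_smul])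
    simpa using this
  · have := hN.conj_mem _ hda c
    simpa [mul_assoc] using this

/-- Double counting: translates of `badSet a` by elements that conjugate `a` to distinct elements
modulo `N` cover each vertex a bounded number of times. -/
lemma card_mul_ncard_badSet_le [Finite (K.quotient N).V] {a : Γ} {M : ℕ}
    (hfin : ∀ x, (K.moveSet r x).Finite) (hM : ∀ x, (K.moveSet r x).ncard ≤ M) (T : Finset Γ)
    (hT : ∀ t ∈ T, t ∈ conjugatesOf a) (hinj : ∀ t ∈ T, ∀ t' ∈ T, t * t'⁻¹ ∈ N → t = t') :
    T.card * (K.badSet N r a).ncard ≤ Nat.card (K.quotient N).V * M := by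
  classical
  have := Fintype.ofFinite (K.quotient N).V
  rw [Nat.card_eq_fintype_card, ← Finset.card_univ]
  refine Finset.card_mul_le_card_mul (fun t q => q ∈ K.badSet N r t) (fun t ht => ?_) fun q _ => ?_
  · obtain ⟨c, rfl⟩ := isConj_iff.1 (hT t ht)
    rw [← Set.ncard_coe_finset]
    refine Set.ncard_le_ncard_of_injOn (c • ·) (fun q hq => ?_)
      (MulAction.injective c).injOn (Finset.finite_toSet _)
    simpa [Finset.bipartiteAbove] using smul_mem_badSet hq
  · obtain ⟨x, rfl⟩ := proj_surjective q
    refine le_trans ?_ (hM x)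
    have hex : ∀ t ∈ T.bipartiteBelow (fun t q => q ∈ K.badSet N r t) (K.proj N x),
        ∃ c ∈ K.moveSet r x, c * t⁻¹ ∈ N := by
      intro t ht
      exact exists_mem_moveSet_of_proj_mem_badSet (Finset.mem_filter.1 ht).2
    choose! f hf hf' using hex
    rw [← Set.ncard_coe_finset]
    refine Set.ncard_le_ncard_of_injOn f (fun t ht => hf t ht) ?_ (hfin x)
    intro t ht t' ht' h
    refine hinj t (Finset.mem_filter.1 ht).1 t' (Finset.mem_filter.1 ht').1 ?_
    have h1 := N.mul_mem (N.inv_mem (hf' t ht)) (h ▸ hf' t' ht')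
    simpa [mul_assoc] using h1

/-- The proportion of vertices of `K / N n` that are bad for some element of `G` with infinite
conjugacy class tends to `0`. -/
lemma eventually_mul_ncard_badSet_le [Finite (MulAction.orbitRel.Quotient Γ K.V)] (hD : K.DegLE D)
    (hproper : ∀ x : K.V, Finite (MulAction.stabilizer Γ x)) {G : Subgroup Γ} [Finite G]
    {N : ℕ → Subgroup Γ} [∀ n, (N n).Normal] [∀ n, (N n).FiniteIndex]
    (hN : Antitone N) (hN' : ⨅ n, N n = ⊥) (r m : ℕ) :
    ∀ᶠ n in atTop, m * (⋃ k ∈ (fcSubgroup G : Set G)ᶜ, K.badSet (N n) r (k : Γ)).ncard ≤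
      Nat.card (K.quotient (N n)).V := by
  obtain ⟨M, hM0, hM⟩ := exists_ncard_moveSet_le hD hproper r
  have key : ∀ k ∈ (fcSubgroup G : Set G)ᶜ, ∀ᶠ n in atTop,
      (m * Nat.card G) * (K.badSet (N n) r (k : Γ)).ncard ≤ Nat.card (K.quotient (N n)).V := by
    intro k hk
    -- with `M * (m * |G|)` conjugates the proportion of bad vertices for `k` is at most `1 / (m * |G|)`
    obtain ⟨T, hT, hTc⟩ := (show (conjugatesOf (k : Γ)).Infinite from hk).exists_subset_card_eq
      (M * (m * Nat.card G))
    filter_upwards [eventually_eq_one_of_mem hN hN'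
      (Set.Finite.image2 (fun a b => a * b⁻¹) T.finite_toSet T.finite_toSet)] with n hn
    have := card_mul_ncard_badSet_le (N := N n) (finite_moveSet hD hproper r) hM T
      (fun t ht => hT ht) fun t ht t' ht' h => mul_inv_eq_one.1 (hn _ ⟨t, ht, t', ht', rfl⟩ h)
    rw [hTc, mul_comm _ M, mul_assoc] at this
    exact Nat.le_of_mul_le_mul_left this hM0
  filter_upwards [(Filter.eventually_all_finite (Set.toFinite _)).2 key] with n hn
  have := Fintype.ofFinite G
  classical
  refine Nat.le_of_mul_le_mul_left (c := Nat.card G) ?_ Nat.card_pos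
  have hU : (⋃ k ∈ (fcSubgroup G : Set G)ᶜ, K.badSet (N n) r (k : Γ)).ncard ≤
      ∑ k ∈ (fcSubgroup G : Set G)ᶜ.toFinset, (K.badSet (N n) r (k : Γ)).ncard := by
    refine le_trans (le_of_eq ?_) (Finset.set_ncard_biUnion_le _ _)
    simp
  calc Nat.card G * (m * _) = (m * Nat.card G) * _ := by ring
    _ ≤ (m * Nat.card G) * _ := Nat.mul_le_mul_left _ hU
    _ = ∑ k ∈ (fcSubgroup G : Set G)ᶜ.toFinset, (m * Nat.card G) *
          (K.badSet (N n) r (k : Γ)).ncard := Finset.mul_sum _ _ _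
    _ ≤ ∑ k ∈ (fcSubgroup G : Set G)ᶜ.toFinset, Nat.card (K.quotient (N n)).V :=
        Finset.sum_le_sum fun k hk => hn k (by simpa using hk)
    _ ≤ Nat.card G * Nat.card (K.quotient (N n)).V := by
        rw [Finset.sum_const, smul_eq_mul]
        refine Nat.mul_le_mul_right _ ?_
        rw [Nat.card_eq_fintype_card]
        exact Finset.card_le_univ _

end GComplex

/-! ### Convergence -/

namespace GComplex

open RootedSpace

variable {Γ : Type u} [Group Γ] (K : GComplex Γ)

lemma law_apply {G : Type u} [Group G] (X : GComplex G) {D : ℕ} (hX : X.DegLE D) [Finite X.V]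
    [Fintype X.V] [Nonempty X.V] {U : Set (RootedSpace G D 1)} (hU : MeasurableSet U) :
    (X.law hX : Measure (RootedSpace G D 1)) U =
      (Nat.card X.V : ℝ≥0∞)⁻¹ * ∑ x : X.V, U.indicator 1 (X.pt hX x) := by
  have hinst : ‹Fintype X.V› = Fintype.ofFinite X.V := Subsingleton.elim _ _
  subst hinst
  let := Fintype.ofFinite X.V
  change (∑ x : X.V, (Nat.card X.V : ℝ≥0∞)⁻¹ • Measure.dirac (X.pt hX x) : Measure _) U = _
  simp only [Measure.coe_finsetSum, Finset.sum_apply, Measure.smul_apply,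
    Measure.dirac_apply' _ hU, smul_eq_mul, Finset.mul_sum]

section Lift

variable (N : Subgroup Γ) [N.Normal]

/-- A lift of a vertex of `K / N`. -/
noncomputable def lift (q : (K.quotient N).V) : K.V := Function.surjInv proj_surjective q

lemma proj_lift (q : (K.quotient N).V) : K.proj N (K.lift N q) = q :=
  Function.surjInv_eq _ q

lemma lift_injective : Function.Injective (K.lift N) := Function.injective_surjInv _

open Classical in
lemma isFundamentalDomain_lift [Fintype (K.quotient N).V] :
    K.IsFundamentalDomain N (Finset.univ.image (K.lift N)) := by
  intro x
  refine ⟨K.lift N (K.proj N x), ⟨Finset.mem_image_of_mem _ (Finset.mem_univ _), ?_⟩, ?_⟩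
  · obtain ⟨n, hn, h⟩ := proj_eq_iff.1 (K.proj_lift N (K.proj N x))
    exact ⟨⟨n, hn⟩, h⟩
  · rintro y ⟨hy, n, rfl⟩
    obtain ⟨q, _, hq⟩ := Finset.mem_image.1 hy
    have : K.proj N x = q := by
      rw [← K.proj_lift N q, hq, eq_comm]
      exact proj_eq_iff.2 ⟨n, n.2, rfl⟩
    rw [this, hq]

open Classical in
/-- If `N` acts freely then averaging over its orbits is averaging over the vertices of `K / N`. -/
lemma tsum_domainWeight_lift [Fintype (K.quotient N).V]
    (hfree : ∀ x : K.V, ∀ n ∈ N, n • x = x → n = 1) (φ : K.V → ℝ≥0∞) :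
    ∑' x, K.domainWeight N (Finset.univ.image (K.lift N)) x * φ x = ∑ q, φ (K.lift N q) := by
  rw [tsum_domainWeight, Finset.sum_image fun _ _ _ _ h => K.lift_injective N h]
  refine Finset.sum_congr rfl fun q _ => ?_
  have : MulAction.stabilizer N (K.lift N q) = ⊥ :=
    (Subgroup.eq_bot_iff_forall _).2 fun n hn => Subtype.ext (hfree _ n n.2 hn)
  rw [this]
  simp

end Lift

variable {K} {D : ℕ} (hD : K.DegLE D)

/-- Any radius beyond some bound witnesses that the points `ind [K, Hx]` lying in an open set lie in
its interior: there are only finitely many such points. -/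
lemma exists_radius {G : Type u} [Group G] (H : Subgroup G) (f : H →* Γ) {Γ₀ : Subgroup Γ}
    {F : Finset K.V} (hF : K.IsFundamentalDomain Γ₀ F) (hc : ∀ c ∈ Γ₀, ∀ h, Commute c (f h))
    {U : Set (RootedSpace G D 1)} (hU : IsOpen U) :
    ∃ r, ∀ x : K.V, RootedSpace.ind H ((K.restrict f).pt (restrict_degLE hD f) x) ∈ U → ∀ y,
      BallIso r (RootedSpace.ind H ((K.restrict f).pt (restrict_degLE hD f) x)) y → y ∈ U := by
  have : ∀ x : K.V, ∃ n, RootedSpace.ind H ((K.restrict f).pt (restrict_degLE hD f) x) ∈ U →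
      ∀ r, n ≤ r → ∀ y,
        BallIso r (RootedSpace.ind H ((K.restrict f).pt (restrict_degLE hD f) x)) y → y ∈ U := by
    intro x
    by_cases hx : RootedSpace.ind H ((K.restrict f).pt (restrict_degLE hD f) x) ∈ U
    · obtain ⟨n, hn⟩ := exists_ballIso_mem hU hx
      exact ⟨n, fun _ => hn⟩
    · exact ⟨0, fun h => absurd h hx⟩
  choose n hn using this
  refine ⟨F.sup n, fun x hx y hy => ?_⟩
  obtain ⟨z, ⟨hz, c, rfl⟩, _⟩ := hF x
  have hpt := K.pt_smul f hD (hc c c.2) x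
  have hpt' : (K.restrict f).pt (restrict_degLE hD f) x =
    (K.restrict f).pt (restrict_degLE hD f) (c • x : K.V) := hpt.symm
  rw [hpt'] at hx hy
  exact hn _ hx _ (Finset.le_sup hz) y hy

/-- The laws of the quotients `K / N n` converge weakly. By the portmanteau theorem it is enough to
bound the mass of open sets `U` from below. Averaging over `Γ₀`-orbits may be replaced by averaging
over the vertices `q` of `K / N n`, and unless `q` is bad the point `[K / N n, Gq]` agrees on a large
ball with the point of the limit law that corresponds to a lift of `q`. -/
theorem tendsto_law_quotient [Nonempty K.V]
    (hproper : ∀ x : K.V, Finite (MulAction.stabilizer Γ x))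
    [Finite (MulAction.orbitRel.Quotient Γ K.V)] (G : Subgroup Γ) [Finite G]
    (N : ℕ → Subgroup Γ) [∀ n, (N n).Normal] [∀ n, (N n).FiniteIndex]
    (hN : Antitone N) (hN' : ⨅ n, N n = ⊥) (Γ₀ : Subgroup Γ) [Γ₀.FiniteIndex]
    (hc : ∀ c ∈ Γ₀, ∀ h, Commute c ((G.subtype.comp (fcSubgroup G).subtype) h))
    (F₀ : Finset K.V) (hF₀ : K.IsFundamentalDomain Γ₀ F₀) :
    Tendsto (fun n => ((K.quotient (N n)).restrict G.subtype).law
        (restrict_degLE (quotient_degLE hD (N n)) G.subtype)) atTop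
      (𝓝 (indLaw (fcSubgroup G)
        (K.orbitLaw hD (G.subtype.comp (fcSubgroup G).subtype) Γ₀ F₀ hF₀ hproper))) := by
  classical
  refine tendsto_of_forall_isOpen_le_liminf' fun U hU => ?_
  set H := fcSubgroup G
  set f := G.subtype.comp H.subtype
  let φ : K.V → ℝ≥0∞ := fun x =>
    U.indicator 1 (RootedSpace.ind H ((K.restrict f).pt (restrict_degLE hD f) x))
  have hφ : ∀ c : Γ, (∀ h, Commute c (f h)) → ∀ x, φ (c • x) = φ x := fun c hc x =>
    congrArg (fun z => U.indicator 1 (RootedSpace.ind H z)) (K.pt_smul f hD hc x)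
  set A := ∑' x, K.domainWeight Γ₀ F₀ x
  have hμ : (indLaw H (K.orbitLaw hD f Γ₀ F₀ hF₀ hproper) : Measure (RootedSpace G D 1)) U =
      A⁻¹ * ∑' x, K.domainWeight Γ₀ F₀ x * φ x := by
    rw [← lintegral_indicator_one hU.measurableSet]
    exact K.lintegral_indLaw_orbitLaw hD H f Γ₀ F₀ hF₀ hproper _
  -- the limit law has total mass `1`, so its normalizing constant is neither `0` nor `∞`
  have hA : A⁻¹ * A = 1 := by
    have := K.lintegral_indLaw_orbitLaw hD H f Γ₀ F₀ hF₀ hproper fun _ => 1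
    simpa using this.symm
  have hA0 : A ≠ 0 := by
    intro h
    simp [h] at hA
  have hAtop : A ≠ ⊤ := by
    intro h
    simp [h] at hA
  obtain ⟨r, hr⟩ := exists_radius hD H f hF₀ hc hU
  refine le_of_forall_lt fun a ha => ?_
  -- it is enough to bound `μ U - 1 / m` by the mass of `U` under the late laws
  obtain ⟨m, hm⟩ := ENNReal.exists_inv_nat_lt (tsub_pos_of_lt ha).ne'
  have hm0 : (m : ℝ≥0∞)⁻¹ ≠ ⊤ := (hm.trans_le le_top).ne
  have hmpos : (m : ℝ≥0∞) ≠ 0 := by simpa using hm0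
  refine lt_of_lt_of_le (b := _ - (m : ℝ≥0∞)⁻¹) (lt_tsub_iff_left.2
    (add_comm a _ ▸ lt_tsub_iff_left.1 hm)) (le_liminf_of_le (by isBoundedDefault) ?_)
  filter_upwards [eventually_mul_ncard_badSet_le hD hproper (G := G) hN hN' (r + 1) m,
    eventually_eq_of_mem_moveSet hD hproper (G := G) hN hN' (r + 1),
    eventually_commute_fcSubgroup (G := G) hN hN'] with n hbad hmove hcomm
  rw [tsub_le_iff_right, hμ]
  have := Fintype.ofFinite (K.quotient (N n)).V
  set B := ⋃ k ∈ (H : Set G)ᶜ, K.badSet (N n) (r + 1) (k : Γ)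
  let V := (K.quotient (N n)).V
  -- stabilizers move `x` by distance `0`, so the case `k = 1` shows that `N n` acts freely
  have hfree : ∀ x : K.V, ∀ c ∈ N n, c • x = x → c = 1 := fun x c hcN hcx =>
    hmove x c ⟨x, by simp, by simp [hcx]⟩ 1 H.one_mem (by simpa using hcN)
  -- the average over the orbits of `Γ₀` is the average over the vertices of `K / N n`
  have havg : A⁻¹ * ∑' x, K.domainWeight Γ₀ F₀ x * φ x =
      (Nat.card V : ℝ≥0∞)⁻¹ * ∑ q, φ (K.lift (N n) q) := by
    have h1 := (K.isWeight_domainWeight Γ₀ F₀ hF₀ hproper).tsum_mul_comm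
      (K.isWeight_domainWeight (N n) _ (K.isFundamentalDomain_lift (N n)) hproper) (φ := φ)
      (fun c hcΓ => hφ c (hc c hcΓ)) (fun c hcN => hφ c fun h => hcomm c hcN h h.2)
    have h2 := K.tsum_domainWeight_lift (N n) hfree fun _ => 1
    simp only [mul_one, Finset.sum_const, Finset.card_univ, nsmul_eq_mul] at h2
    rw [K.tsum_domainWeight_lift (N n) hfree, h2, ← Nat.card_eq_fintype_card] at h1
    have hV0 : (Nat.card V : ℝ≥0∞) ≠ 0 := by exact_mod_cast Nat.card_pos.ne'
    have hVtop : (Nat.card V : ℝ≥0∞) ≠ ⊤ := ENNReal.natCast_ne_top _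
    rw [mul_comm, mul_comm (Nat.card V : ℝ≥0∞)⁻¹, ← div_eq_mul_inv, ← div_eq_mul_inv,
      ENNReal.div_eq_div_iff hV0 hVtop hA0 hAtop, mul_comm _ (∑' x, _ : ℝ≥0∞), h1, mul_comm]
  have hle : ∀ q : V, φ (K.lift (N n) q) ≤
      U.indicator 1 (((K.quotient (N n)).restrict G.subtype).pt
        (restrict_degLE (quotient_degLE hD (N n)) G.subtype) q) + B.indicator 1 q := by
    intro q
    by_cases hq : q ∈ B
    · refine le_trans ?_ (le_add_of_nonneg_left zero_le)
      rw [Set.indicator_of_mem hq]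
      exact Set.indicator_le_self' (fun _ _ => zero_le) _
    by_cases hφq : RootedSpace.ind H ((K.restrict f).pt (restrict_degLE hD f) (K.lift (N n) q)) ∈ U
    · have hmem := hr _ hφq (((K.quotient (N n)).restrict G.subtype).pt
        (restrict_degLE (quotient_degLE hD (N n)) G.subtype) q) (by
          have := ball_quotient_isIso (N := N n) H hD (r := r) (x := K.lift (N n) q)
            (fun c hcm k hck => by
              have hk : k ∈ H := by
                by_contra hk
                exact hq (Set.mem_biUnion (show k ∈ (H : Set G)ᶜ from hk)
                  ⟨_, K.proj_lift (N n) q, c, hcm, hck⟩)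
              exact ⟨hmove _ c hcm k hk hck, hk⟩)
          rw [K.proj_lift] at this
          exact this)
      rw [Set.indicator_of_mem hmem]
      refine le_trans ?_ (le_add_of_nonneg_right zero_le)
      exact Set.indicator_le_self' (fun _ _ => zero_le) _
    · have : φ (K.lift (N n) q) = 0 := Set.indicator_of_notMem hφq _
      rw [this]
      exact zero_le
  have hBsum : ∑ q : V, B.indicator (1 : V → ℝ≥0∞) q = B.ncard := by
    rw [Set.ncard_eq_toFinset_card', ← Set.filter_mem_univ_eq_toFinset, ← Finset.sum_boole]
    exact Finset.sum_congr rfl fun q _ => Set.indicator_apply _ _ _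
  let : Fintype ((K.quotient (N n)).restrict G.subtype).V := ‹Fintype (K.quotient (N n)).V›
  have hlaw := law_apply ((K.quotient (N n)).restrict G.subtype)
    (restrict_degLE (quotient_degLE hD (N n)) G.subtype) hU.measurableSet
  rw [havg]
  refine le_trans (mul_le_mul_right (Finset.sum_le_sum fun q _ => hle q) _) ?_
  rw [Finset.sum_add_distrib, hBsum, mul_add]
  refine add_le_add hlaw.ge ?_
  rw [mul_comm, ← div_eq_mul_inv]
  refine ENNReal.div_le_of_le_mul ?_
  rw [mul_comm, ← div_eq_mul_inv, ENNReal.le_div_iff_mul_le (.inl hmpos) (.inl (by simp)),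
    mul_comm]
  exact_mod_cast hbad

end GComplex

theorem proposition3 {Γ : Type u} [Group Γ] (D : ℕ)
    (K : GComplex Γ) [Nonempty K.V] (hD : K.DegLE D)
    (hsimp : K.IsSimplicialAction)
    (hproper : ∀ x : K.V, Finite (MulAction.stabilizer Γ x))
    [hcocompact : Finite (MulAction.orbitRel.Quotient Γ K.V)]
    (G : Subgroup Γ) [Finite G]
    (N : ℕ → Subgroup Γ) [∀ n, (N n).Normal] [∀ n, (N n).FiniteIndex]
    (hN : Antitone N) (hN' : ⨅ n, N n = ⊥)
    (Γ₀ : Subgroup Γ) [Γ₀.FiniteIndex]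
    (hΓ₀ : ∀ h ∈ fcSubgroup G, Γ₀ ≤ Subgroup.centralizer {(h : Γ)})
    (F₀ : Finset K.V) (hF₀ : K.IsFundamentalDomain Γ₀ F₀) :
    RootedSpace.IsUnimodular (RootedSpace.indLaw (fcSubgroup G)
        (K.orbitLaw hD (G.subtype.comp (fcSubgroup G).subtype) Γ₀ F₀ hF₀ hproper)) ∧
      Tendsto (fun n => ((K.quotient (N n)).restrict G.subtype).law
          (GComplex.restrict_degLE (GComplex.quotient_degLE hD (N n)) G.subtype)) atTop
        (𝓝 (RootedSpace.indLaw (fcSubgroup G)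
          (K.orbitLaw hD (G.subtype.comp (fcSubgroup G).subtype) Γ₀ F₀ hF₀ hproper))) := by
  have hc : ∀ c ∈ Γ₀, ∀ h, Commute c ((G.subtype.comp (fcSubgroup G).subtype) h) := fun c hcΓ h =>
    (Subgroup.mem_centralizer_iff.1 (hΓ₀ h h.2 hcΓ) _ rfl).symm
  exact ⟨K.isUnimodular_indLaw_orbitLaw hD _ _ Γ₀ F₀ hF₀ hproper hc,
    GComplex.tendsto_law_quotient hD hproper G N hN hN' Γ₀ hc F₀ hF₀⟩
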